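/- Let $\Lambda$ be a finite index set, let $\Omega\subset\mathbb R^d$ be open, bounded and connected, and let $X\subset\Omega$ be compact with non-empty interior. For each $i\in\Lambda$ let $\varphi_i\colon\Omega\to\Omega$ be a $C^{1+\varepsilon}$-diffeomorphism onto its image ($\varepsilon>0$; that is, $\varphi_i$ is $C^1$ with locally $\varepsilon$-Hölder continuous derivative) that is conformal, i.e. $\varphi_i'(x)$ is a similarity for every $x\in\Omega$, and suppose that $\varphi_i(X)\subset X$ and that $\varphi_i$ is a contraction on $X$. Let $F\subset X$ be the limit set (the self-conformal set), i.e. the unique non-empty compact set with $F=\bigcup_{i\in\Lambda}\varphi_i(F)$, and suppose that the strong separation condition holds: $\varphi_i(F)\cap\varphi_j(F)=\emptyset$ for $i\neq j$. Let $p_i\colon X\to(0,1)$, $i\in\Lambda$, be Hölder continuous with $\sum_{i\in\Lambda}p_i(x)=1$ for all $x\in X$, and let $\mu$ be a Borel probability measure on $X$ with support $F$ that is invariant with place dependent probabilities $p_i$, i.e. $$\mu(B)=\sum_{i\in\Lambda}\int_{\varphi_i^{-1}(B)}p_i(x)\,d\mu(x)\qquad\text{for all Borel sets }B\subset X.$$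 Let $\Sigma=\Lambda^{\mathbb N}$ with left shift $\sigma$. For $\mathbf i=(i_1,i_2,\ldots)\in\Sigma$ write $\varphi_{\mathbf i|_n}=\varphi_{i_1}\circ\cdots\circ\varphi_{i_n}$, and let $\pi\colon\Sigma\to F$ be the coding map, $\{\pi(\mathbf i)\}=\bigcap_{n\ge1}\varphi_{\mathbf i|_n}(F)$. Let $P(\Sigma)$ be the set of periodic words, and for $\mathbf i\in P(\Sigma)$ with (least) period $n$ put $$\overline p_{\mathbf i}=\prod_{k=1}^{n}p_{i_k}\big(\pi(\sigma^{k}\mathbf i)\big),\qquad |\varphi'_{\mathbf i}|=\big|\varphi_{\mathbf i|_n}'(\pi(\mathbf i))\big|,$$ where $|\cdot|$ on the right is the operator norm. The pointwise Assouad dimension of $\mu$ at $x$ is $$\dim_{\mathrm A}(\mu,x)=\inf\Big\{s>0:\ \exists\,C>0\ \text{such that}\ \frac{\mu(B(x,R))}{\mu(B(x,r))}\le C\Big(\frac Rr\Big)^s\ \text{for all }0<r<R\Big\}\in[0,\infty],$$ where $B(x,r)$ denotes the closed ball. Then for $\mu$-almost every $x$, $$\dim_{\mathrm A}(\mu,x)=\sup_{\mathbf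 i\in P(\Sigma)}\frac{\log\overline p_{\mathbf i}}{\log|\varphi'_{\mathbf i}|}.$$ -/

import Mathlib

open MeasureTheory Set
open scoped NNReal ENNReal

noncomputable section

namespace ConformalIFS

/-- The pointwise Assouad dimension `dim_A(μ, x)`: the infimum, in `[0, ∞]`, of all `s > 0` for which
`μ(B(x,R)) / μ(B(x,r)) ≤ C (R/r)^s` for all `0 < r < R`, with a constant `C > 0` that may depend
on `x`; `B(x,r)` is the closed ball. -/
def pointwiseAssouadDim {E : Type*} [MetricSpace E] [MeasurableSpace E]
    (μ : Measure E) (x : E) : EReal :=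
  sInf ((fun s : ℝ => (s : EReal)) '' {s : ℝ | 0 < s ∧ ∃ C : ℝ, 0 < C ∧ ∀ r R : ℝ, 0 < r → r < R →
    μ (Metric.closedBall x R) / μ (Metric.closedBall x r) ≤ ENNReal.ofReal (C * (R / r) ^ s)})

section

variable {Λ : Type*} {d : ℕ}

/-- `φ` is a self-conformal iterated function system with respect to the bounded domain `Ω` and
the compact set `X ⊆ Ω`: each `φ i` maps `X` into itself and is a contraction there, and it is a
conformal `C^{1+ε}` diffeomorphism of `Ω` onto its image in `Ω`. Values of `φ i` outside `Ω` play
no role. -/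
structure IsSelfConformal (φ : Λ → EuclideanSpace ℝ (Fin d) → EuclideanSpace ℝ (Fin d))
    (Ω X : Set (EuclideanSpace ℝ (Fin d))) : Prop where
  isOpen_domain : IsOpen Ω
  isBounded_domain : Bornology.IsBounded Ω
  isConnected_domain : IsConnected Ω
  isCompact_X : IsCompact X
  interior_nonempty : (interior X).Nonempty
  subset_domain : X ⊆ Ω
  mapsTo_X : ∀ i, MapsTo (φ i) X X
  contraction : ∀ i, ∃ c : ℝ≥0, c < 1 ∧ LipschitzOnWith c (φ i) X
  mapsTo_domain : ∀ i, MapsTo (φ i) Ω Ω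
  injOn_domain : ∀ i, InjOn (φ i) Ω
  contDiffOn : ∀ i, ContDiffOn ℝ 1 (φ i) Ω
  /-- The derivatives are (locally) Hölder continuous with exponent `ε`. -/
  holder_deriv : ∃ ε : ℝ≥0, 0 < ε ∧ ∀ i, ∀ x ∈ Ω, ∃ U ∈ nhds x, ∃ C : ℝ≥0,
    HolderOnWith C ε (fderiv ℝ (φ i)) (U ∩ Ω)
  /-- Conformality: the derivative at every point of `Ω` is a similarity. -/
  conformal : ∀ i, ∀ x ∈ Ω, ∃ c : ℝ, 0 < c ∧ ∀ y, ‖fderiv ℝ (φ i) x y‖ = c * ‖y‖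

/-- `F` is the limit set of the system `φ` on `X`: the non-empty compact subset of `X` with
`F = ⋃ i, φ i (F)`. -/
structure IsLimitSet (φ : Λ → EuclideanSpace ℝ (Fin d) → EuclideanSpace ℝ (Fin d))
    (X F : Set (EuclideanSpace ℝ (Fin d))) : Prop where
  nonempty : F.Nonempty
  isCompact : IsCompact F
  subset : F ⊆ X
  invariant : F = ⋃ i, φ i '' F

/-- The strong separation condition. -/
def StrongSeparation (φ : Λ → EuclideanSpace ℝ (Fin d) → EuclideanSpace ℝ (Fin d))
    (F : Set (EuclideanSpace ℝ (Fin d))) : Prop :=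
  ∀ i j, i ≠ j → Disjoint (φ i '' F) (φ j '' F)

/-- `p` is a family of Hölder continuous functions `X → (0,1)` whose sum is identically `1`. -/
structure IsPlaceDependentProb [Fintype Λ] (p : Λ → EuclideanSpace ℝ (Fin d) → ℝ)
    (X : Set (EuclideanSpace ℝ (Fin d))) : Prop where
  holder : ∀ i, ∃ C α : ℝ≥0, 0 < α ∧ HolderOnWith C α (p i) X
  mem_Ioo : ∀ i, ∀ x ∈ X, p i x ∈ Ioo (0 : ℝ) 1
  sum_eq_one : ∀ x ∈ X, ∑ i, p i x = 1

/-- `μ` is a Borel probability measure on `X` that is invariant for the place dependent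
probabilities `p`: `μ(B) = ∑ i, ∫_{φ i ⁻¹ (B)} p i dμ` for all Borel sets `B ⊆ X`. -/
structure IsInvariantMeasure [Fintype Λ]
    (φ : Λ → EuclideanSpace ℝ (Fin d) → EuclideanSpace ℝ (Fin d))
    (p : Λ → EuclideanSpace ℝ (Fin d) → ℝ) (X : Set (EuclideanSpace ℝ (Fin d)))
    (μ : Measure (EuclideanSpace ℝ (Fin d))) : Prop where
  isProbabilityMeasure : IsProbabilityMeasure μ
  compl_null : μ Xᶜ = 0
  invariant : ∀ B ⊆ X, MeasurableSet B →
    μ B = ∑ i, ∫⁻ x in X ∩ φ i ⁻¹' B, ENNReal.ofReal (p i x) ∂μ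

/-- The left shift on infinite words; the letters of a word are indexed from `0`. -/
def shift (w : ℕ → Λ) : ℕ → Λ := fun n => w (n + 1)

/-- `φ_{w|n}`, the composition of the maps of the first `n` letters of `w`, the first letter being
applied last. -/
def prefixMap (φ : Λ → EuclideanSpace ℝ (Fin d) → EuclideanSpace ℝ (Fin d)) (w : ℕ → Λ) :
    ℕ → EuclideanSpace ℝ (Fin d) → EuclideanSpace ℝ (Fin d)
  | 0 => id
  | n + 1 => prefixMap φ w n ∘ φ (w n)

/-- The coding map: `π(w)` is the point with `{π(w)} = ⋂_{n ≥ 1} φ_{w|n}(F)`. -/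
def codingMap (φ : Λ → EuclideanSpace ℝ (Fin d) → EuclideanSpace ℝ (Fin d))
    (F : Set (EuclideanSpace ℝ (Fin d))) (w : ℕ → Λ) : EuclideanSpace ℝ (Fin d) :=
  Classical.epsilon fun x => {x} = ⋂ n : ℕ, prefixMap φ w (n + 1) '' F

/-- For a periodic word `w = (w₁, w₂, …)` with period of length `n`,
`p̄_w = ∏_{k=1}^n p_{w_k}(π(σ^k w))`. -/
def periodProb (φ : Λ → EuclideanSpace ℝ (Fin d) → EuclideanSpace ℝ (Fin d))
    (F : Set (EuclideanSpace ℝ (Fin d))) (p : Λ → EuclideanSpace ℝ (Fin d) → ℝ)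
    (w : ℕ → Λ) : ℝ :=
  ∏ k ∈ Finset.range (Function.minimalPeriod shift w), p (w k) (codingMap φ F (shift^[k + 1] w))

/-- For a periodic word `w` with period of length `n`, the operator norm of the derivative of
`φ_{w|n}` at `π(w)`. -/
def periodDeriv (φ : Λ → EuclideanSpace ℝ (Fin d) → EuclideanSpace ℝ (Fin d))
    (F : Set (EuclideanSpace ℝ (Fin d))) (w : ℕ → Λ) : ℝ :=
  ‖fderiv ℝ (prefixMap φ w (Function.minimalPeriod shift w)) (codingMap φ F w)‖

end

end ConformalIFS

end

/-! The proof compares balls with cylinders and reduces the statement to one inequality between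
finite words. For a word `u` let `a_u` and `p_u` be the products of the derivative norms and of the
probabilities along `φ_u`, evaluated at some point of `F`. Hölder continuity and contraction make
the total distortion summable. Hence, up to one constant `K`, the choice of point is irrelevant,
`φ_u` scales distances in `F` by `a_u`, and `μ (φ_u (F))` is `p_u`. Strong separation puts the rest
of `F` at distance at least a constant times `a_u` from `φ_u (F)`. All this is collected in
`UniformEstimates` and proved in `exists_uniformEstimates`.

A pair of radii `r < R` at `x` therefore corresponds to a block `v` of the coding of `x` with `a_v`
of order `r / R`, and the ratio of the ball measures is of order `1 / p_v`. If `a_v ^ s ≤ C p_v` for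
all words, then `s` is admissible at every point of `F` (`exists_measure_div_le`). Conversely,
almost every `x` has every finite word in its coding (`measure_diff_iUnion_cylinder`), so an
exponent `s` admissible at such an `x` gives `a_v ^ s ≤ C p_v` for all words.

Periodic words remove the constant. At the fixed point of `φ_v` both products are exactly
multiplicative along powers of `v`, and taking `N`-th roots yields `a_v ^ s ≤ p_v`
(`cocycle_rpow_le_of_measure_div_le`). In the other direction every non-empty finite word is a power
of the first period of a periodic word, so the sharp inequality at periodic points returns, by
distortion, the inequality with a constant for all words (`exists_cocycle_rpow_le`). -/

namespace ConformalIFS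

open Filter Topology

/-! ### Local-to-global Hölder estimates -/

/-- On a compact set, local Hölder type bounds for a function of two points are global. -/
lemma exists_le_mul_dist_rpow {E : Type*} [PseudoMetricSpace E] {F : Set E} (hF : IsCompact F)
    {q : E → E → ℝ} {ε : ℝ}
    (h : ∀ x ∈ F, ∀ y ∈ F, ∃ C : ℝ, ∀ᶠ z in 𝓝[F ×ˢ F] (x, y),
      z.1 ≠ z.2 → |q z.1 z.2| ≤ C * dist z.1 z.2 ^ ε) :
    ∃ C : ℝ, 0 ≤ C ∧ ∀ x ∈ F, ∀ y ∈ F, x ≠ y → |q x y| ≤ C * dist x y ^ ε := by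
  have key : ∃ C : ℝ, 0 ≤ C ∧ ∀ z ∈ F ×ˢ F, z.1 ≠ z.2 → |q z.1 z.2| ≤ C * dist z.1 z.2 ^ ε := by
    -- Compactness of `F ×ˢ F`, diagonal included: the property passes to unions by taking the
    -- larger constant, so a local constant near each pair suffices.
    refine (hF.prod hF).induction_on
      (p := fun s => ∃ C : ℝ, 0 ≤ C ∧ ∀ z ∈ s, z.1 ≠ z.2 → |q z.1 z.2| ≤ C * dist z.1 z.2 ^ ε)
      ⟨0, le_rfl, by simp⟩ ?_ ?_ ?_
    · rintro s t hst ⟨C, hC, H⟩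
      exact ⟨C, hC, fun z hz => H z (hst hz)⟩
    · rintro s t ⟨C, hC, H⟩ ⟨C', hC', H'⟩
      refine ⟨max C C', hC.trans (le_max_left _ _), ?_⟩
      rintro z (hz | hz) hne
      · exact (H z hz hne).trans (by gcongr; exact le_max_left _ _)
      · exact (H' z hz hne).trans (by gcongr; exact le_max_right _ _)
    · rintro ⟨x, y⟩ ⟨hx, hy⟩
      obtain ⟨C, hC⟩ := h x hx y hy
      refine ⟨_, hC, max C 0, le_max_right _ _, fun z hz hne => (hz hne).trans ?_⟩
      gcongr
      exact le_max_left _ _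
  obtain ⟨C, hC, H⟩ := key
  exact ⟨C, hC, fun x hx y hy hne => H (x, y) ⟨hx, hy⟩ hne⟩

/-- Away from the diagonal, continuity gives the local bound of `exists_le_mul_dist_rpow`. -/
lemma eventually_le_mul_dist_rpow_of_continuousWithinAt {E : Type*} [MetricSpace E] {F : Set E}
    {q : E → E → ℝ} {ε : ℝ} {x y : E} (hxy : x ≠ y)
    (hq : ContinuousWithinAt (fun z : E × E => q z.1 z.2) (F ×ˢ F) (x, y)) :
    ∃ C : ℝ, ∀ᶠ z in 𝓝[F ×ˢ F] (x, y), z.1 ≠ z.2 → |q z.1 z.2| ≤ C * dist z.1 z.2 ^ ε := by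
  have hd : ContinuousWithinAt (fun z : E × E => dist z.1 z.2 ^ ε) (F ×ˢ F) (x, y) :=
    (continuous_dist.continuousAt.rpow_const (Or.inl (dist_ne_zero.2 hxy))).continuousWithinAt
  have hpos : dist x y ^ ε ≠ 0 := (Real.rpow_pos_of_pos (dist_pos.2 hxy) _).ne'
  have hc : ContinuousWithinAt (fun z : E × E => |q z.1 z.2| / dist z.1 z.2 ^ ε) (F ×ˢ F) (x, y) :=
    hq.abs.div hd hpos
  refine ⟨|q x y| / dist x y ^ ε + 1, ?_⟩
  have := hc.eventually (gt_mem_nhds (lt_add_one _))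
  filter_upwards [this] with z hz hne
  have : 0 < dist z.1 z.2 ^ ε := Real.rpow_pos_of_pos (dist_pos.2 hne) _
  exact ((div_lt_iff₀ this).1 hz).le

/-- From `log t ≤ t - 1`, the logarithm is Lipschitz with constant `1 / m` on `[m, ∞)`. -/
lemma abs_log_sub_log_le {s t m : ℝ} (hm : 0 < m) (hs : m ≤ s) (ht : m ≤ t) :
    |Real.log s - Real.log t| ≤ |s - t| / m := by
  have aux : ∀ {a b : ℝ}, m ≤ a → m ≤ b → Real.log a - Real.log b ≤ |a - b| / m := by
    intro a b ha hb
    have ha' := hm.trans_le ha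
    have hb' := hm.trans_le hb
    rw [← Real.log_div ha'.ne' hb'.ne']
    calc Real.log (a / b) ≤ a / b - 1 := Real.log_le_sub_one_of_pos (by positivity)
      _ = (a - b) / b := by field_simp
      _ ≤ |a - b| / b := by gcongr; exact le_abs_self _
      _ ≤ |a - b| / m := by gcongr
  rw [abs_le]
  constructor
  · have := aux ht hs
    rw [abs_sub_comm] at this
    linarith
  · exact aux hs ht

/-- The logarithm of a positive, locally Hölder continuous function on a compact set is Hölder
continuous. -/
lemma exists_abs_log_sub_log_le {E : Type*} [MetricSpace E] {F : Set E} (hF : IsCompact F)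
    {g : E → ℝ} {ε : ℝ} (hε : 0 < ε) (hpos : ∀ x ∈ F, 0 < g x)
    (h : ∀ x ∈ F, ∃ C : ℝ, ∃ U ∈ 𝓝 x, ∀ y ∈ U ∩ F, ∀ z ∈ U ∩ F,
      |g y - g z| ≤ C * dist y z ^ ε) :
    ∃ C : ℝ, 0 ≤ C ∧ ∀ x ∈ F, ∀ y ∈ F, x ≠ y →
      |Real.log (g x) - Real.log (g y)| ≤ C * dist x y ^ ε := by
  have hcont : ContinuousOn g F := by
    intro x hx
    obtain ⟨C, U, hU, H⟩ := h x hx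
    rw [ContinuousWithinAt, tendsto_iff_dist_tendsto_zero]
    have h0 : Tendsto (fun y => C * dist y x ^ ε) (𝓝[F] x) (𝓝 0) := by
      have : ContinuousAt (fun y => C * dist y x ^ ε) x :=
        ((continuous_id.dist continuous_const).continuousAt.rpow_const (Or.inr hε.le)).const_mul C
      have := this.tendsto
      simp only [dist_self, Real.zero_rpow hε.ne', mul_zero] at this
      exact this.mono_left nhdsWithin_le_nhds
    refine squeeze_zero' (Eventually.of_forall fun _ => dist_nonneg) ?_ h0
    filter_upwards [self_mem_nhdsWithin, nhdsWithin_le_nhds hU] with y hy hyU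
    exact H y ⟨hyU, hy⟩ x ⟨mem_of_mem_nhds hU, hx⟩
  have hlog : ContinuousOn (fun x => Real.log (g x)) F :=
    hcont.log fun x hx => (hpos x hx).ne'
  refine exists_le_mul_dist_rpow hF (q := fun x y => Real.log (g x) - Real.log (g y)) ?_
  intro x hx y hy
  by_cases hxy : x = y
  · subst hxy
    obtain ⟨C, U, hU, H⟩ := h x hx
    have hm : 0 < g x / 2 := half_pos (hpos x hx)
    have hlarge : ∀ᶠ y in 𝓝[F] x, g x / 2 < g y :=
      (hcont x hx).eventually (lt_mem_nhds (half_lt_self (hpos x hx)))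
    have hgood : ∀ᶠ y in 𝓝[F] x, g x / 2 < g y ∧ y ∈ U ∩ F := by
      filter_upwards [hlarge, self_mem_nhdsWithin, nhdsWithin_le_nhds hU] with y h1 h2 h3
      exact ⟨h1, h3, h2⟩
    refine ⟨C / (g x / 2), ?_⟩
    rw [nhdsWithin_prod_eq]
    filter_upwards [hgood.prod_mk hgood] with z hz _
    calc |Real.log (g z.1) - Real.log (g z.2)| ≤ |g z.1 - g z.2| / (g x / 2) :=
          abs_log_sub_log_le hm hz.1.1.le hz.2.1.le
      _ ≤ (C * dist z.1 z.2 ^ ε) / (g x / 2) := by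
          gcongr; exact H _ hz.1.2 _ hz.2.2
      _ = C / (g x / 2) * dist z.1 z.2 ^ ε := by ring
  · refine eventually_le_mul_dist_rpow_of_continuousWithinAt
      (q := fun x y => Real.log (g x) - Real.log (g y)) hxy ?_
    have h1 : ContinuousWithinAt (fun z : E × E => Real.log (g z.1)) (F ×ˢ F) (x, y) :=
      (hlog x hx).comp (t := F) (f := Prod.fst) (x := (x, y)) continuousWithinAt_fst fun z hz => hz.1
    have h2 : ContinuousWithinAt (fun z : E × E => Real.log (g z.2)) (F ×ˢ F) (x, y) :=
      (hlog y hy).comp (t := F) (f := Prod.snd) (x := (x, y)) continuousWithinAt_snd fun z hz => hz.2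
    exact h1.sub h2

/-- For an injective conformal map with Hölder continuous derivative, the logarithm of the
difference quotient is close to the logarithm of the norm of the derivative. -/
lemma exists_abs_log_dist_sub_log_norm_fderiv_le {E : Type*} [NormedAddCommGroup E]
    [NormedSpace ℝ E] {F Ω : Set E} (hF : IsCompact F) (hΩ : IsOpen Ω) (hFΩ : F ⊆ Ω)
    {f : E → E} (hf : DifferentiableOn ℝ f Ω) (hinj : InjOn f Ω)
    {ε : ℝ} (hε : 0 < ε) (hpos : ∀ x ∈ F, 0 < ‖fderiv ℝ f x‖)
    (hconf : ∀ x ∈ Ω, ∀ v, ‖fderiv ℝ f x v‖ = ‖fderiv ℝ f x‖ * ‖v‖)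
    (h : ∀ x ∈ Ω, ∃ C : ℝ, ∃ U ∈ 𝓝 x, ∀ y ∈ U ∩ Ω, ∀ z ∈ U ∩ Ω,
      ‖fderiv ℝ f y - fderiv ℝ f z‖ ≤ C * dist y z ^ ε) :
    ∃ C : ℝ, 0 ≤ C ∧ ∀ x ∈ F, ∀ y ∈ F, x ≠ y →
      |Real.log (dist (f x) (f y) / dist x y) - Real.log ‖fderiv ℝ f x‖| ≤ C * dist x y ^ ε := by
  have hcont : ∀ x ∈ Ω, ContinuousAt (fun y => ‖fderiv ℝ f y‖) x := by
    intro x hx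
    obtain ⟨C, U, hU, H⟩ := h x hx
    refine ContinuousAt.norm ?_
    rw [ContinuousAt, tendsto_iff_norm_sub_tendsto_zero]
    have h0 : Tendsto (fun y => C * dist y x ^ ε) (𝓝 x) (𝓝 0) := by
      have : ContinuousAt (fun y => C * dist y x ^ ε) x :=
        ((continuous_id.dist continuous_const).continuousAt.rpow_const (Or.inr hε.le)).const_mul C
      have := this.tendsto
      simpa only [dist_self, Real.zero_rpow hε.ne', mul_zero] using this
    refine squeeze_zero' (Eventually.of_forall fun _ => norm_nonneg _) ?_ h0
    filter_upwards [hΩ.mem_nhds hx, hU] with y hy hyU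
    exact H y ⟨hyU, hy⟩ x ⟨mem_of_mem_nhds hU, hx⟩
  refine exists_le_mul_dist_rpow hF
    (q := fun x y => Real.log (dist (f x) (f y) / dist x y) - Real.log ‖fderiv ℝ f x‖) ?_
  intro x hx y hy
  by_cases hxy : x = y
  · subst hxy
    obtain ⟨C₀, U, hU, H₀⟩ := h x (hFΩ hx)
    obtain ⟨C, hC, H⟩ : ∃ C : ℝ, 0 ≤ C ∧ ∀ y ∈ U ∩ Ω, ∀ z ∈ U ∩ Ω,
        ‖fderiv ℝ f y - fderiv ℝ f z‖ ≤ C * dist y z ^ ε :=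
      ⟨max C₀ 0, le_max_right _ _, fun y hy z hz =>
        (H₀ y hy z hz).trans (by gcongr; exact le_max_left _ _)⟩
    obtain ⟨ρ, hρ, hball⟩ := Metric.mem_nhds_iff.1 (inter_mem hU (hΩ.mem_nhds (hFΩ hx)))
    set m := ‖fderiv ℝ f x‖ with hm
    have hm0 : 0 < m := hpos x hx
    have hball_mem : ∀ᶠ y in 𝓝 x, y ∈ Metric.ball x ρ := Metric.ball_mem_nhds x hρ
    have hlarge : ∀ᶠ y in 𝓝 x, m / 2 < ‖fderiv ℝ f y‖ :=
      (hcont x (hFΩ hx)).eventually (lt_mem_nhds (half_lt_self hm0))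
    -- With `‖f'‖ > m / 2` and an error below `m / 4`, the difference quotient stays above `m / 4`,
    -- where the logarithm is Lipschitz.
    have hsmall : ∀ᶠ z : E × E in 𝓝 (x, x), C * dist z.1 z.2 ^ ε < m / 4 := by
      have : ContinuousAt (fun z : E × E => C * dist z.1 z.2 ^ ε) (x, x) :=
        (continuous_dist.continuousAt.rpow_const (Or.inr hε.le)).const_mul C
      refine this.eventually (gt_mem_nhds ?_)
      simp only [dist_self, Real.zero_rpow hε.ne', mul_zero]
      linarith
    refine ⟨C / (m / 4), ?_⟩
    refine nhdsWithin_le_nhds ?_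
    rw [nhds_prod_eq] at hsmall ⊢
    filter_upwards [(hball_mem.and hlarge).prod_mk hball_mem, hsmall] with z hz hzs hne
    obtain ⟨⟨h1, h1'⟩, h2⟩ := hz
    have hseg : segment ℝ z.1 z.2 ⊆ Metric.ball x ρ := (convex_ball x ρ).segment_subset h1 h2
    -- Mean value inequality for `f - f' (z.1)` on a segment inside a ball where the Hölder bound
    -- holds; conformality then makes the linear term have norm exactly `‖f' (z.1)‖` times the
    -- distance.
    have hmv : ‖f z.2 - f z.1 - fderiv ℝ f z.1 (z.2 - z.1)‖
        ≤ (C * dist z.1 z.2 ^ ε) * ‖z.2 - z.1‖ := by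
      refine (convex_segment z.1 z.2).norm_image_sub_le_of_norm_hasFDerivWithin_le'
        (f' := fderiv ℝ f) ?_ ?_ (left_mem_segment ℝ z.1 z.2) (right_mem_segment ℝ z.1 z.2)
      · intro w hw
        exact ((hf w (hball (hseg hw)).2).differentiableAt
          (hΩ.mem_nhds (hball (hseg hw)).2)).hasFDerivAt.hasFDerivWithinAt
      · intro w hw
        refine (H w (hball (hseg hw)) z.1 (hball h1)).trans ?_
        have := segment_subset_closedBall_left z.1 z.2 hw
        rw [Metric.mem_closedBall] at this
        gcongr
    have hd : 0 < dist z.1 z.2 := dist_pos.2 hne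
    rw [← dist_eq_norm z.2 z.1, dist_comm z.2 z.1] at hmv
    have hq : |dist (f z.1) (f z.2) / dist z.1 z.2 - ‖fderiv ℝ f z.1‖| ≤ C * dist z.1 z.2 ^ ε := by
      have h3 := abs_norm_sub_norm_le (f z.2 - f z.1) (fderiv ℝ f z.1 (z.2 - z.1))
      rw [hconf _ (hball h1).2, ← dist_eq_norm z.2 z.1, ← dist_eq_norm (f z.2), dist_comm z.2,
        dist_comm (f z.2)] at h3
      have h4 : dist (f z.1) (f z.2) / dist z.1 z.2 - ‖fderiv ℝ f z.1‖
          = (dist (f z.1) (f z.2) - ‖fderiv ℝ f z.1‖ * dist z.1 z.2) / dist z.1 z.2 := by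
        field_simp
      rw [h4, abs_div, abs_of_pos hd, div_le_iff₀ hd]
      exact h3.trans hmv
    have hlow : m / 4 ≤ dist (f z.1) (f z.2) / dist z.1 z.2 := by
      have := (abs_le.1 hq).1
      linarith
    calc _ ≤ |dist (f z.1) (f z.2) / dist z.1 z.2 - ‖fderiv ℝ f z.1‖| / (m / 4) :=
          abs_log_sub_log_le (by positivity) hlow (by linarith)
      _ ≤ (C * dist z.1 z.2 ^ ε) / (m / 4) := by gcongr
      _ = C / (m / 4) * dist z.1 z.2 ^ ε := by ring
  · refine eventually_le_mul_dist_rpow_of_continuousWithinAt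
      (q := fun x y => Real.log (dist (f x) (f y) / dist x y) - Real.log ‖fderiv ℝ f x‖)
      hxy (ContinuousAt.continuousWithinAt ?_)
    have hfx : ContinuousAt f x := (hf.continuousOn).continuousAt (hΩ.mem_nhds (hFΩ hx))
    have hfy : ContinuousAt f y := (hf.continuousOn).continuousAt (hΩ.mem_nhds (hFΩ hy))
    have h1 : ContinuousAt (fun z : E × E => f z.1) (x, y) :=
      ContinuousAt.comp (g := f) (f := Prod.fst) (x := (x, y)) hfx continuousAt_fst
    have h2 : ContinuousAt (fun z : E × E => f z.2) (x, y) :=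
      ContinuousAt.comp (g := f) (f := Prod.snd) (x := (x, y)) hfy continuousAt_snd
    have h3 : ContinuousAt (fun z : E × E => ‖fderiv ℝ f z.1‖) (x, y) :=
      ContinuousAt.comp (g := fun y => ‖fderiv ℝ f y‖) (f := Prod.fst) (x := (x, y))
        (hcont x (hFΩ hx)) continuousAt_fst
    -- Off the diagonal, injectivity keeps the quotient nonzero, so its logarithm is continuous.
    have hfne : f x ≠ f y := fun e => hxy (hinj (hFΩ hx) (hFΩ hy) e)
    refine ContinuousAt.sub (ContinuousAt.log ((h1.dist h2).div continuous_dist.continuousAt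
      (dist_ne_zero.2 hxy)) ?_) (h3.log (hpos x hx).ne')
    exact div_ne_zero (dist_ne_zero.2 hfne) (dist_ne_zero.2 hxy)

/-! ### Finite words and cocycles -/

section Words

variable {Λ E : Type*}

/-- The composition `φ_{i₁} ∘ ⋯ ∘ φ_{iₙ}` of the maps of the letters of a finite word. -/
def wordMap (φ : Λ → E → E) : List Λ → E → E
  | [] => id
  | i :: u => φ i ∘ wordMap φ u

/-- The product of the values of the `g i` along the orbit that defines `wordMap φ u x`. -/
def cocycle (φ : Λ → E → E) (g : Λ → E → ℝ) : List Λ → E → ℝ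
  | [], _ => 1
  | i :: u, x => g i (wordMap φ u x) * cocycle φ g u x

variable {φ : Λ → E → E} {g : Λ → E → ℝ} {F : Set E}

@[simp] lemma wordMap_nil (x : E) : wordMap φ [] x = x := rfl

@[simp] lemma wordMap_cons (i : Λ) (u : List Λ) (x : E) :
    wordMap φ (i :: u) x = φ i (wordMap φ u x) := rfl

@[simp] lemma cocycle_nil (x : E) : cocycle φ g [] x = 1 := rfl

@[simp] lemma cocycle_cons (i : Λ) (u : List Λ) (x : E) :
    cocycle φ g (i :: u) x = g i (wordMap φ u x) * cocycle φ g u x := rfl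

lemma wordMap_append (u v : List Λ) (x : E) :
    wordMap φ (u ++ v) x = wordMap φ u (wordMap φ v x) := by
  induction u with
  | nil => rfl
  | cons i u ih => simp [ih]

lemma cocycle_append (u v : List Λ) (x : E) :
    cocycle φ g (u ++ v) x = cocycle φ g u (wordMap φ v x) * cocycle φ g v x := by
  induction u with
  | nil => simp
  | cons i u ih => simp [ih, wordMap_append, mul_assoc]

lemma wordMap_mem (h : ∀ i, MapsTo (φ i) F F) (u : List Λ) {x : E} (hx : x ∈ F) :
    wordMap φ u x ∈ F := by
  induction u with
  | nil => exact hx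
  | cons i u ih => exact h i ih

lemma injOn_wordMap (h : ∀ i, MapsTo (φ i) F F) (hinj : ∀ i, InjOn (φ i) F) (u : List Λ) :
    InjOn (wordMap φ u) F := by
  induction u with
  | nil => exact injOn_id F
  | cons i u ih => exact (hinj i).comp ih fun x hx => wordMap_mem h u hx

lemma cocycle_pos (h : ∀ i, MapsTo (φ i) F F) (hg : ∀ i, ∀ x ∈ F, 0 < g i x) (u : List Λ)
    {x : E} (hx : x ∈ F) : 0 < cocycle φ g u x := by
  induction u with
  | nil => exact one_pos
  | cons i u ih => exact mul_pos (hg i _ (wordMap_mem h u hx)) ih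

end Words

/-! ### Bounded distortion -/

section Distortion

variable {Λ E : Type*} [MetricSpace E] {φ : Λ → E → E} {F : Set E} {c D : ℝ}

lemma dist_wordMap_le_pow (hc : 0 ≤ c) (hmaps : ∀ i, MapsTo (φ i) F F)
    (hcon : ∀ i, ∀ x ∈ F, ∀ y ∈ F, dist (φ i x) (φ i y) ≤ c * dist x y) (u : List Λ) {x y : E}
    (hx : x ∈ F) (hy : y ∈ F) :
    dist (wordMap φ u x) (wordMap φ u y) ≤ c ^ u.length * dist x y := by
  induction u with
  | nil => simp
  | cons i u ih =>
    calc _ ≤ c * dist (wordMap φ u x) (wordMap φ u y) :=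
          hcon i _ (wordMap_mem hmaps u hx) _ (wordMap_mem hmaps u hy)
      _ ≤ c * (c ^ u.length * dist x y) := by gcongr
      _ = c ^ (i :: u).length * dist x y := by rw [List.length_cons, pow_succ]; ring

/-- Hölder bounds are summable along the scales `c ^ k * D`. -/
lemma exists_summable_modulus [Fintype Λ] (hc : 0 < c) (hc1 : c < 1) (hD : 0 ≤ D)
    {q : Λ → E → E → ℝ}
    (hq : ∀ i, ∃ ε : ℝ, 0 < ε ∧ ∃ C : ℝ, 0 ≤ C ∧ ∀ x ∈ F, ∀ y ∈ F, x ≠ y →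
      |q i x y| ≤ C * dist x y ^ ε) :
    ∃ ω : ℕ → ℝ, (∀ k, 0 ≤ ω k) ∧ Summable ω ∧ ∀ i k, ∀ x ∈ F, ∀ y ∈ F, x ≠ y →
      dist x y ≤ c ^ k * D → |q i x y| ≤ ω k := by
  choose ε hε C hC H using hq
  refine ⟨fun k => ∑ i, C i * (c ^ k * D) ^ ε i,
    fun k => Finset.sum_nonneg fun i _ => mul_nonneg (hC i) (by positivity), ?_, ?_⟩
  · refine summable_sum fun i _ => ?_
    have : ∀ k : ℕ, C i * (c ^ k * D) ^ ε i = C i * D ^ ε i * (c ^ ε i) ^ k := by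
      intro k
      rw [Real.mul_rpow (by positivity) hD, ← Real.rpow_natCast, ← Real.rpow_natCast,
        ← Real.rpow_mul hc.le, ← Real.rpow_mul hc.le, mul_comm (k : ℝ)]
      ring
    simp_rw [this]
    exact (summable_geometric_of_lt_one (by positivity)
      (Real.rpow_lt_one hc.le hc1 (hε i))).mul_left _
  · intro i k x hx y hy hne hd
    calc |q i x y| ≤ C i * dist x y ^ ε i := H i x hx y hy hne
      _ ≤ C i * (c ^ k * D) ^ ε i := by
          have := hC i
          have := (hε i).le
          gcongr
      _ ≤ ∑ i, C i * (c ^ k * D) ^ ε i :=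
          Finset.single_le_sum (f := fun i => C i * (c ^ k * D) ^ ε i)
            (fun i _ => mul_nonneg (hC i) (by positivity)) (Finset.mem_univ i)

/-- The logarithm of the cocycle is a sum over letters. A letter applied after `k` others sees two
points at distance at most `c ^ k * D`, so it contributes at most `ω k`, and summability of `ω`
makes the bound uniform in the word. -/
lemma abs_log_cocycle_sub_le (hc : 0 ≤ c) (hmaps : ∀ i, MapsTo (φ i) F F)
    (hcon : ∀ i, ∀ x ∈ F, ∀ y ∈ F, dist (φ i x) (φ i y) ≤ c * dist x y)
    (hD : ∀ x ∈ F, ∀ y ∈ F, dist x y ≤ D) {g : Λ → E → ℝ} (hg : ∀ i, ∀ x ∈ F, 0 < g i x)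
    {ω : ℕ → ℝ} (hω0 : ∀ k, 0 ≤ ω k)
    (hω : ∀ i k, ∀ x ∈ F, ∀ y ∈ F, x ≠ y → dist x y ≤ c ^ k * D →
      |Real.log (g i x) - Real.log (g i y)| ≤ ω k) (u : List Λ) {x y : E}
    (hx : x ∈ F) (hy : y ∈ F) :
    |Real.log (cocycle φ g u x) - Real.log (cocycle φ g u y)|
      ≤ ∑ k ∈ Finset.range u.length, ω k := by
  induction u with
  | nil => simp
  | cons i u ih =>
    have hux := wordMap_mem hmaps u hx
    have huy := wordMap_mem hmaps u hy
    have hstep : |Real.log (g i (wordMap φ u x)) - Real.log (g i (wordMap φ u y))|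
        ≤ ω u.length := by
      by_cases hne : wordMap φ u x = wordMap φ u y
      · simpa [hne] using hω0 _
      · refine hω i _ _ hux _ huy hne ((dist_wordMap_le_pow hc hmaps hcon u hx hy).trans ?_)
        gcongr
        exact hD x hx y hy
    rw [List.length_cons, Finset.sum_range_succ, cocycle_cons, cocycle_cons,
      Real.log_mul (hg i _ hux).ne' (cocycle_pos hmaps hg u hx).ne',
      Real.log_mul (hg i _ huy).ne' (cocycle_pos hmaps hg u hy).ne', add_sub_add_comm, add_comm]
    exact (abs_add_le _ _).trans (add_le_add ih hstep)

/-- The distance quotient of `φ_u` telescopes into those of the single maps, each compared with `a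
i` at the orbit of `x`; the errors add up as in `abs_log_cocycle_sub_le`. -/
lemma abs_log_dist_wordMap_sub_le (hc : 0 ≤ c) (hmaps : ∀ i, MapsTo (φ i) F F)
    (hinj : ∀ i, InjOn (φ i) F)
    (hcon : ∀ i, ∀ x ∈ F, ∀ y ∈ F, dist (φ i x) (φ i y) ≤ c * dist x y)
    (hD : ∀ x ∈ F, ∀ y ∈ F, dist x y ≤ D) {a : Λ → E → ℝ} (ha : ∀ i, ∀ x ∈ F, 0 < a i x)
    {ω : ℕ → ℝ}
    (hω : ∀ i k, ∀ x ∈ F, ∀ y ∈ F, x ≠ y → dist x y ≤ c ^ k * D →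
      |Real.log (dist (φ i x) (φ i y) / dist x y) - Real.log (a i x)| ≤ ω k) (u : List Λ) {x y : E}
    (hx : x ∈ F) (hy : y ∈ F) (hxy : x ≠ y) :
    |Real.log (dist (wordMap φ u x) (wordMap φ u y) / dist x y) - Real.log (cocycle φ a u x)|
      ≤ ∑ k ∈ Finset.range u.length, ω k := by
  induction u with
  | nil => simp [(dist_pos.2 hxy).ne']
  | cons i u ih =>
    have hux := wordMap_mem hmaps u hx
    have huy := wordMap_mem hmaps u hy
    have hune : wordMap φ u x ≠ wordMap φ u y :=
      fun e => hxy (injOn_wordMap hmaps hinj u hx hy e)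
    have hne' : wordMap φ (i :: u) x ≠ wordMap φ (i :: u) y :=
      fun e => hxy (injOn_wordMap hmaps hinj (i :: u) hx hy e)
    have hstep := hω i u.length _ hux _ huy hune
      ((dist_wordMap_le_pow hc hmaps hcon u hx hy).trans (by gcongr; exact hD x hx y hy))
    have hd := dist_pos.2 hxy
    have hdu := dist_pos.2 hune
    have hd' := dist_pos.2 hne'
    rw [List.length_cons, Finset.sum_range_succ, cocycle_cons,
      Real.log_mul (ha i _ hux).ne' (cocycle_pos hmaps ha u hx).ne']
    have hsplit : dist (wordMap φ (i :: u) x) (wordMap φ (i :: u) y) / dist x y =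
        dist (wordMap φ (i :: u) x) (wordMap φ (i :: u) y) / dist (wordMap φ u x) (wordMap φ u y) *
          (dist (wordMap φ u x) (wordMap φ u y) / dist x y) := by
      field_simp
    rw [hsplit, Real.log_mul (by positivity) (by positivity), add_sub_add_comm, add_comm]
    exact (abs_add_le _ _).trans (add_le_add ih hstep)

lemma le_exp_mul_of_abs_log_sub_le {s t W : ℝ} (hs : 0 < s) (ht : 0 < t)
    (h : |Real.log s - Real.log t| ≤ W) : s ≤ Real.exp W * t := by
  rw [← Real.log_le_log_iff hs (by positivity), Real.log_mul (by positivity) ht.ne', Real.log_exp]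
  linarith [(abs_le.1 h).2]

end Distortion

/-! ### Measures of cylinders -/

lemma continuousOn_wordMap {Λ E : Type*} [TopologicalSpace E] {φ : Λ → E → E} {F : Set E}
    (hmaps : ∀ i, MapsTo (φ i) F F)
    (hcont : ∀ i, ContinuousOn (φ i) F)
    (u : List Λ) : ContinuousOn (wordMap φ u) F := by
  induction u with
  | nil => exact continuousOn_id
  | cons i u ih => exact (hcont i).comp ih fun x hx => wordMap_mem hmaps u hx

section Measure

variable {Λ E : Type*} [MetricSpace E] [MeasurableSpace E] [BorelSpace E] [PolishSpace E]
  {φ : Λ → E → E} {F : Set E} {c D : ℝ} {μ : Measure E} {p : Λ → E → ℝ}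

lemma measurableSet_image_wordMap (hmaps : ∀ i, MapsTo (φ i) F F)
    (hcont : ∀ i, ContinuousOn (φ i) F) (hinj : ∀ i, InjOn (φ i) F) (u : List Λ) {A : Set E}
    (hA : MeasurableSet A) (hAF : A ⊆ F) : MeasurableSet (wordMap φ u '' A) :=
  hA.image_of_continuousOn_injOn ((continuousOn_wordMap hmaps hcont u).mono hAF)
    ((injOn_wordMap hmaps hinj u).mono hAF)

/-- The Gibbs property: `μ (φ_u (A))` is comparable to `p_u μ(A)`. -/
lemma measureReal_image_wordMap_mem_Icc [IsFiniteMeasure μ] (hc : 0 ≤ c)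
    (hmaps : ∀ i, MapsTo (φ i) F F)
    (hcont : ∀ i, ContinuousOn (φ i) F) (hinj : ∀ i, InjOn (φ i) F)
    (hcon : ∀ i, ∀ x ∈ F, ∀ y ∈ F, dist (φ i x) (φ i y) ≤ c * dist x y)
    (hD : ∀ x ∈ F, ∀ y ∈ F, dist x y ≤ D) (hp : ∀ i, ∀ x ∈ F, 0 < p i x)
    {ω : ℕ → ℝ} (hω0 : ∀ k, 0 ≤ ω k)
    (hω : ∀ i k, ∀ x ∈ F, ∀ y ∈ F, x ≠ y → dist x y ≤ c ^ k * D →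
      |Real.log (p i x) - Real.log (p i y)| ≤ ω k)
    (hμ : ∀ i, ∀ A ⊆ F, MeasurableSet A →
      μ (φ i '' A) = ∫⁻ x in A, ENNReal.ofReal (p i x) ∂μ)
    (u : List Λ) {z : E} (hz : z ∈ F) {A : Set E} (hAF : A ⊆ F) (hA : MeasurableSet A) :
    μ.real (wordMap φ u '' A) ∈
      Icc (Real.exp (-∑ k ∈ Finset.range u.length, ω k) * cocycle φ p u z * μ.real A)
        (Real.exp (∑ k ∈ Finset.range u.length, ω k) * cocycle φ p u z * μ.real A) := by
  induction u with
  | nil => simp [wordMap]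
  | cons i u ih =>
    set B := wordMap φ u '' A with hB
    have hBm : MeasurableSet B := measurableSet_image_wordMap hmaps hcont hinj u hA hAF
    have hBF : B ⊆ F := by
      rintro _ ⟨x, hx, rfl⟩
      exact wordMap_mem hmaps u (hAF hx)
    have himg : wordMap φ (i :: u) '' A = φ i '' B := by
      rw [hB, image_image]; rfl
    have hzu := wordMap_mem hmaps u hz
    have hpz := hp i _ hzu
    -- `B` lies within `c ^ u.length * D` of `φ_u z`, so `p i` is constant on `B` up to the factor
    -- `exp (ω u.length)` and can be pulled out of the integral for `μ (φ_i (B))`.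
    have hlog : ∀ y ∈ B, |Real.log (p i y) - Real.log (p i (wordMap φ u z))| ≤ ω u.length := by
      rintro _ ⟨x, hx, rfl⟩
      by_cases hne : wordMap φ u x = wordMap φ u z
      · simpa [hne] using hω0 _
      · refine hω i _ _ (wordMap_mem hmaps u (hAF hx)) _ hzu hne
          ((dist_wordMap_le_pow hc hmaps hcon u (hAF hx) hz).trans ?_)
        gcongr
        exact hD x (hAF hx) z hz
    have hcoc := cocycle_pos hmaps hp u hz
    have hup : μ.real (φ i '' B) ≤ Real.exp (ω u.length) * p i (wordMap φ u z) * μ.real B := by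
      refine ENNReal.toReal_le_of_le_ofReal (by positivity) ?_
      rw [hμ i B hBF hBm, ENNReal.ofReal_mul (by positivity), ofReal_measureReal,
        ← setLIntegral_const]
      refine setLIntegral_mono' hBm fun y hy => ENNReal.ofReal_le_ofReal ?_
      exact le_exp_mul_of_abs_log_sub_le (hp i y (hBF hy)) hpz (hlog y hy)
    have hlo : Real.exp (-ω u.length) * p i (wordMap φ u z) * μ.real B ≤ μ.real (φ i '' B) := by
      refine (ENNReal.ofReal_le_iff_le_toReal (measure_ne_top _ _)).1 ?_
      rw [hμ i B hBF hBm, ENNReal.ofReal_mul (by positivity), ofReal_measureReal,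
        ← setLIntegral_const]
      refine setLIntegral_mono' hBm fun y hy => ENNReal.ofReal_le_ofReal ?_
      rw [Real.exp_neg, inv_mul_le_iff₀ (Real.exp_pos _)]
      exact le_exp_mul_of_abs_log_sub_le hpz (hp i y (hBF hy)) (by
        rw [abs_sub_comm]; exact hlog y hy)
    rw [himg, List.length_cons, Finset.sum_range_succ, cocycle_cons, neg_add, Real.exp_add,
      Real.exp_add]
    constructor
    · refine le_trans ?_ hlo
      calc _ = Real.exp (-ω u.length) * p i (wordMap φ u z) *
            (Real.exp (-∑ k ∈ Finset.range u.length, ω k) * cocycle φ p u z * μ.real A) := by ring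
        _ ≤ _ := by gcongr; exact ih.1
    · refine hup.trans ?_
      calc _ ≤ Real.exp (ω u.length) * p i (wordMap φ u z) *
            (Real.exp (∑ k ∈ Finset.range u.length, ω k) * cocycle φ p u z * μ.real A) := by
              gcongr; exact ih.2
        _ = _ := by ring

end Measure

/-- The invariance equation restricted to one cylinder. -/
lemma IsInvariantMeasure.measure_image_eq {Λ : Type*} [Fintype Λ] {d : ℕ}
    {φ : Λ → EuclideanSpace ℝ (Fin d) → EuclideanSpace ℝ (Fin d)}
    {p : Λ → EuclideanSpace ℝ (Fin d) → ℝ} {X F : Set (EuclideanSpace ℝ (Fin d))}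
    {μ : Measure (EuclideanSpace ℝ (Fin d))} (hμ : IsInvariantMeasure φ p X μ)
    (hFX : F ⊆ X) (hμF : μ Fᶜ = 0) (hmaps : ∀ i, MapsTo (φ i) F F)
    (hcont : ∀ i, ContinuousOn (φ i) F) (hinj : ∀ i, InjOn (φ i) F) (hsep : StrongSeparation φ F)
    (i : Λ) {A : Set (EuclideanSpace ℝ (Fin d))} (hAF : A ⊆ F) (hA : MeasurableSet A) :
    μ (φ i '' A) = ∫⁻ x in A, ENNReal.ofReal (p i x) ∂μ := by
  classical
  have hB : MeasurableSet (φ i '' A) :=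
    hA.image_of_continuousOn_injOn ((hcont i).mono hAF) ((hinj i).mono hAF)
  have hBX : φ i '' A ⊆ X := by
    rintro _ ⟨x, hx, rfl⟩
    exact hFX (hmaps i (hAF hx))
  -- Invariance integrates over `X`, but separation is available only on `F`; since `μ` is carried
  -- by `F`, the domain can be cut down to it.
  have hae : ∀ j, (X ∩ φ j ⁻¹' (φ i '' A) : Set _) =ᵐ[μ] (F ∩ φ j ⁻¹' (φ i '' A) : Set _) := by
    intro j
    have hF : ∀ᵐ x ∂μ, x ∈ F := hμF
    filter_upwards [hF] with x hx
    exact propext ⟨fun h => ⟨hx, h.2⟩, fun h => ⟨hFX hx, h.2⟩⟩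
  rw [hμ.invariant _ hBX hB, Finset.sum_eq_single i]
  · rw [setLIntegral_congr (hae i)]
    congr 2
    ext x
    constructor
    · rintro ⟨hx, y, hy, hxy⟩
      rwa [← hinj i (hAF hy) hx hxy]
    · exact fun hx => ⟨hAF hx, mem_image_of_mem _ hx⟩
  · intro j _ hj
    rw [setLIntegral_congr (hae j)]
    have : F ∩ φ j ⁻¹' (φ i '' A) = ∅ := by
      rw [eq_empty_iff_forall_notMem]
      rintro x ⟨hx, y, hy, hxy⟩
      exact (hsep j i hj).le_bot ⟨mem_image_of_mem _ hx, y, hAF hy, hxy⟩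
    rw [this, setLIntegral_empty]
  · simp

/-- The root trick: powers of `b / q` that stay bounded force `b / q ≤ 1`, so a constant independent
of `N` is lost. -/
lemma le_of_forall_pow_le_mul_pow {b q C : ℝ} (hq : 0 < q)
    (h : ∀ N : ℕ, b ^ N ≤ C * q ^ N) : b ≤ q := by
  by_contra hlt
  have h1 : 1 < b / q := (one_lt_div hq).2 (not_le.1 hlt)
  obtain ⟨N, hN⟩ := pow_unbounded_of_one_lt C h1
  rw [div_pow, lt_div_iff₀ (by positivity)] at hN
  exact absurd (h N) (not_le.2 hN)

/-! ### Prefixes of infinite words -/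

section Prefix

variable {Λ E : Type*} {φ : Λ → E → E} {g : Λ → E → ℝ}

/-- The word formed by the first `n` letters of `w`. -/
def prefixWord (w : ℕ → Λ) (n : ℕ) : List Λ := (List.range n).map w

@[simp] lemma prefixWord_zero (w : ℕ → Λ) : prefixWord w 0 = [] := rfl

@[simp] lemma length_prefixWord (w : ℕ → Λ) (n : ℕ) : (prefixWord w n).length = n := by
  simp [prefixWord]

lemma prefixWord_succ (w : ℕ → Λ) (n : ℕ) :
    prefixWord w (n + 1) = w 0 :: prefixWord (shift w) n := by
  simp [prefixWord, List.range_succ_eq_map, shift, Function.comp_def]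

lemma prefixWord_succ' (w : ℕ → Λ) (n : ℕ) :
    prefixWord w (n + 1) = prefixWord w n ++ [w n] := by
  simp [prefixWord, List.range_succ]

lemma prefixWord_add (w : ℕ → Λ) (m n : ℕ) :
    prefixWord w (m + n) = prefixWord w m ++ prefixWord (shift^[m] w) n := by
  induction m generalizing w with
  | zero => simp
  | succ m ih =>
    rw [Nat.add_right_comm, prefixWord_succ, ih, prefixWord_succ, List.cons_append,
      Function.iterate_succ_apply]

lemma shift_iterate_apply (w : ℕ → Λ) (m n : ℕ) : shift^[m] w n = w (m + n) := by
  induction m generalizing w with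
  | zero => simp
  | succ m ih =>
    rw [Function.iterate_succ_apply, ih, shift]
    congr 1
    omega

/-- Every point of a covered set has an infinite coding orbit. -/
lemma exists_coding_orbit {F : Set E} (hcover : ∀ x ∈ F, ∃ i, ∃ y ∈ F, φ i y = x) {x : E}
    (hx : x ∈ F) :
    ∃ (w : ℕ → Λ) (T : ℕ → E), T 0 = x ∧ (∀ n, T n ∈ F) ∧
      ∀ m n, wordMap φ (prefixWord (shift^[m] w) n) (T (m + n)) = T m := by
  have : Nonempty Λ := ⟨(hcover x hx).choose⟩
  choose! i y hy hφ using hcover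
  let T : ℕ → E := fun n => y^[n] x
  have hT : ∀ n, T n ∈ F := by
    intro n
    induction n with
    | zero => exact hx
    | succ n ih =>
      simp only [T, Function.iterate_succ_apply']
      exact hy _ ih
  refine ⟨fun n => i (T n), T, rfl, hT, fun m n => ?_⟩
  induction n with
  | zero => simp
  | succ n ih =>
    rw [prefixWord_succ', wordMap_append, ← ih, shift_iterate_apply]
    congr 1
    simp only [wordMap_cons, wordMap_nil, T, ← add_assoc, Function.iterate_succ_apply']
    exact hφ _ (hT (m + n))

end Prefix

/-! ### Uniform estimates and their consequences -/

/-- The uniform estimates satisfied by a self-conformal system with strong separation, and by an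
invariant measure with place dependent probabilities `p`; the functions `a i` are the norms of the
derivatives of the maps. -/
structure UniformEstimates {Λ E : Type*} [MetricSpace E] [MeasurableSpace E] (φ : Λ → E → E)
    (F : Set E) (a p : Λ → E → ℝ) (μ : Measure E) (K c D δ m : ℝ) : Prop where
  one_le : 1 ≤ K
  c_pos : 0 < c
  c_lt_one : c < 1
  D_pos : 0 < D
  δ_pos : 0 < δ
  m_pos : 0 < m
  measurableSet_image : ∀ u : List Λ, ∀ A ⊆ F, MeasurableSet A → MeasurableSet (wordMap φ u '' A)
  measurableSet : MeasurableSet F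
  mapsTo : ∀ i, MapsTo (φ i) F F
  injOn : ∀ i, InjOn (φ i) F
  cover : ∀ x ∈ F, ∃ i, ∃ y ∈ F, φ i y = x
  separation : ∀ i j, i ≠ j → ∀ x ∈ F, ∀ y ∈ F, δ ≤ dist (φ i x) (φ j y)
  dist_le : ∀ x ∈ F, ∀ y ∈ F, dist x y ≤ D
  dist_wordMap_le : ∀ u, ∀ x ∈ F, ∀ y ∈ F,
    dist (wordMap φ u x) (wordMap φ u y) ≤ K * cocycle φ a u x * dist x y
  le_dist_wordMap : ∀ u, ∀ x ∈ F, ∀ y ∈ F,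
    cocycle φ a u x * dist x y ≤ K * dist (wordMap φ u x) (wordMap φ u y)
  a_pos : ∀ i, ∀ x ∈ F, 0 < a i x
  p_pos : ∀ i, ∀ x ∈ F, 0 < p i x
  le_a : ∀ i, ∀ x ∈ F, m ≤ a i x
  cocycle_a_le : ∀ u, ∀ x ∈ F, ∀ y ∈ F, cocycle φ a u x ≤ K * cocycle φ a u y
  cocycle_p_le : ∀ u, ∀ x ∈ F, ∀ y ∈ F, cocycle φ p u x ≤ K * cocycle φ p u y
  cocycle_a_le_pow : ∀ u, ∀ x ∈ F, cocycle φ a u x ≤ K * c ^ u.length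
  measure_le : ∀ u, ∀ z ∈ F, ∀ A ⊆ F, MeasurableSet A →
    μ.real (wordMap φ u '' A) ≤ K * cocycle φ p u z * μ.real A
  le_measure : ∀ u, ∀ z ∈ F, ∀ A ⊆ F, MeasurableSet A →
    cocycle φ p u z * μ.real A ≤ K * μ.real (wordMap φ u '' A)
  measureReal_eq_one : μ.real F = 1
  compl_null : μ Fᶜ = 0

namespace UniformEstimates

variable {Λ E : Type*} [MetricSpace E] [MeasurableSpace E] {φ : Λ → E → E}
    {F : Set E} {a p : Λ → E → ℝ} {μ : Measure E} {K c D δ m : ℝ}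

lemma K_pos (h : UniformEstimates φ F a p μ K c D δ m) : 0 < K := one_pos.trans_le h.one_le

lemma cocycle_a_le_K (h : UniformEstimates φ F a p μ K c D δ m) (u : List Λ) {x : E} (hx : x ∈ F) :
    cocycle φ a u x ≤ K :=
  (h.cocycle_a_le_pow u x hx).trans
    (mul_le_of_le_one_right h.K_pos.le (pow_le_one₀ h.c_pos.le h.c_lt_one.le))

lemma cocycle_a_pos (h : UniformEstimates φ F a p μ K c D δ m) (u : List Λ) {x : E} (hx : x ∈ F) :
    0 < cocycle φ a u x := cocycle_pos h.mapsTo h.a_pos u hx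

lemma cocycle_p_pos (h : UniformEstimates φ F a p μ K c D δ m) (u : List Λ) {x : E} (hx : x ∈ F) :
    0 < cocycle φ p u x := cocycle_pos h.mapsTo h.p_pos u hx

lemma image_wordMap_subset (h : UniformEstimates φ F a p μ K c D δ m) (u : List Λ) :
    wordMap φ u '' F ⊆ F := by
  rintro _ ⟨x, hx, rfl⟩
  exact wordMap_mem h.mapsTo u hx

lemma image_wordMap_append_subset (h : UniformEstimates φ F a p μ K c D δ m) (u v : List Λ) :
    wordMap φ (u ++ v) '' F ⊆ wordMap φ u '' F := by
  rintro _ ⟨x, hx, rfl⟩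
  exact ⟨wordMap φ v x, wordMap_mem h.mapsTo v hx, (wordMap_append u v x).symm⟩

lemma measurableSet_cylinder (h : UniformEstimates φ F a p μ K c D δ m) (u : List Λ) :
    MeasurableSet (wordMap φ u '' F) := h.measurableSet_image u F subset_rfl h.measurableSet

lemma measureReal_cylinder_le (h : UniformEstimates φ F a p μ K c D δ m) (u : List Λ) {z : E}
    (hz : z ∈ F) : μ.real (wordMap φ u '' F) ≤ K * cocycle φ p u z := by
  simpa [h.measureReal_eq_one] using h.measure_le u z hz F subset_rfl h.measurableSet

lemma le_measureReal_cylinder (h : UniformEstimates φ F a p μ K c D δ m) (u : List Λ) {z : E}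
    (hz : z ∈ F) : cocycle φ p u z ≤ K * μ.real (wordMap φ u '' F) := by
  simpa [h.measureReal_eq_one] using h.le_measure u z hz F subset_rfl h.measurableSet

/-- The distance of a point of a cylinder to the points of `F` outside of the cylinder is
comparable to the diameter of the cylinder. -/
lemma le_dist_of_notMem_cylinder (h : UniformEstimates φ F a p μ K c D δ m) (u : List Λ) {x y : E}
    (hx : x ∈ F) (hy : y ∈ F) (hyu : y ∉ wordMap φ u '' F) :
    δ / K ^ 2 * cocycle φ a u x ≤ dist (wordMap φ u x) y := by
  have hK := h.K_pos
  -- Generalised over the common prefix `s` of the two codings. An equal letter moves into `s`; at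
  -- the first different letter separation gives `δ`, which `φ_s` contracts at worst by `a_s / K`.
  -- The second factor `K` comes from bounding the cocycle of the remaining word.
  have key : ∀ (u s : List Λ) (y : E), y ∈ F → y ∉ wordMap φ u '' F →
      δ / K ^ 2 * cocycle φ a (s ++ u) x ≤ dist (wordMap φ (s ++ u) x) (wordMap φ s y) := by
    intro u
    induction u with
    | nil => exact fun s y hy hyu => absurd ⟨y, hy, rfl⟩ hyu
    | cons i u ih =>
      intro s y hy hyu
      obtain ⟨j, y, hy', rfl⟩ := h.cover y hy
      by_cases hij : i = j
      · subst hij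
        have := ih (s ++ [i]) y hy' (by
          rintro ⟨t, ht, rfl⟩
          exact hyu ⟨t, ht, rfl⟩)
        rw [List.append_assoc, wordMap_append s [i] y] at this
        exact this
      · have hux := wordMap_mem h.mapsTo u hx
        have hz := wordMap_mem h.mapsTo (i :: u) hx
        have h1 := h.separation i j hij _ hux _ hy'
        have h2 := h.le_dist_wordMap s _ hz _ (h.mapsTo j hy')
        have h3 := h.cocycle_a_le_K (i :: u) hx
        have h4 := h.cocycle_a_pos s hz
        have h5 := h.δ_pos
        rw [cocycle_append, wordMap_append]
        calc _ ≤ δ / K ^ 2 * (cocycle φ a s (wordMap φ (i :: u) x) * K) := by gcongr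
          _ = cocycle φ a s (wordMap φ (i :: u) x) * δ / K := by field_simp
          _ ≤ cocycle φ a s (wordMap φ (i :: u) x) * dist (wordMap φ (i :: u) x) (φ j y) / K := by
              gcongr; exact h1
          _ ≤ _ := by rw [div_le_iff₀ hK, mul_comm (dist _ _)]; exact h2
  simpa using key u [] y hy hyu

/-- With `cylinder_subset_closedBall`, this lets balls and cylinders be exchanged at radii
comparable to `a_u`. -/
lemma inter_closedBall_subset_cylinder (h : UniformEstimates φ F a p μ K c D δ m) (u : List Λ)
    {x : E} (hx : x ∈ F) {R : ℝ} (hR : R < δ / K ^ 2 * cocycle φ a u x) :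
    Metric.closedBall (wordMap φ u x) R ∩ F ⊆ wordMap φ u '' F := by
  rintro y ⟨hyR, hy⟩
  by_contra hyu
  have := h.le_dist_of_notMem_cylinder u hx hy hyu
  rw [Metric.mem_closedBall, dist_comm] at hyR
  linarith

lemma cylinder_subset_closedBall (h : UniformEstimates φ F a p μ K c D δ m) (u : List Λ)
    {x : E} (hx : x ∈ F) {r : ℝ} (hr : K * cocycle φ a u x * D ≤ r) :
    wordMap φ u '' F ⊆ Metric.closedBall (wordMap φ u x) r := by
  rintro _ ⟨y, hy, rfl⟩
  rw [Metric.mem_closedBall, dist_comm]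
  have := h.K_pos
  have := h.cocycle_a_pos u hx
  exact (h.dist_wordMap_le u x hx y hy).trans (le_trans (by gcongr; exact h.dist_le x hx y hy) hr)

lemma measure_le_of_inter_subset (h : UniformEstimates φ F a p μ K c D δ m) {B S : Set E}
    (hS : B ∩ F ⊆ S) : μ B ≤ μ S := by
  calc μ B ≤ μ (B ∩ F) + μ (B \ F) := by
        rw [← measure_inter_add_sdiff B h.measurableSet]
    _ ≤ μ S + μ Fᶜ := add_le_add (measure_mono hS) (measure_mono fun x hx => hx.2)
    _ = μ S := by rw [h.compl_null, add_zero]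

lemma measureReal_le_of_inter_subset [IsFiniteMeasure μ]
    (h : UniformEstimates φ F a p μ K c D δ m) {B S : Set E}
    (hS : B ∩ F ⊆ S) : μ.real B ≤ μ.real S :=
  ENNReal.toReal_mono (measure_ne_top _ _) (h.measure_le_of_inter_subset hS)

end UniformEstimates

/-- Also correct when `μ B = 0`: the quotient is then `0` or `∞`, and the bound is finite. -/
lemma measure_div_le_ofReal_iff {E : Type*} [MeasurableSpace E] {μ : Measure E} [IsFiniteMeasure μ]
    {A B : Set E} {t : ℝ} (ht : 0 ≤ t) :
    μ A / μ B ≤ ENNReal.ofReal t ↔ μ.real A ≤ t * μ.real B := by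
  rw [ENNReal.div_le_iff_le_mul (Or.inr ENNReal.ofReal_ne_top) (Or.inl (measure_ne_top _ _)),
    ← ofReal_measureReal (s := A), ← ofReal_measureReal (s := B), ← ENNReal.ofReal_mul ht,
    ENNReal.ofReal_le_ofReal_iff (by positivity)]

/-! ### Powers of a word at its fixed point -/

section Replicate

variable {Λ E : Type*} {φ : Λ → E → E}

lemma wordMap_flatten_replicate {v : List Λ} {z : E} (hz : wordMap φ v z = z) (N : ℕ) :
    wordMap φ (List.replicate N v).flatten z = z := by
  induction N with
  | zero => simp
  | succ N ih => rw [List.replicate_succ, List.flatten_cons, wordMap_append, ih, hz]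

lemma cocycle_flatten_replicate {g : Λ → E → ℝ} {v : List Λ} {z : E} (hz : wordMap φ v z = z)
    (N : ℕ) : cocycle φ g (List.replicate N v).flatten z = cocycle φ g v z ^ N := by
  induction N with
  | zero => simp
  | succ N ih =>
    rw [List.replicate_succ, List.flatten_cons, cocycle_append, ih, wordMap_flatten_replicate hz,
      pow_succ']

end Replicate

namespace UniformEstimates

variable {Λ E : Type*} [MetricSpace E] [MeasurableSpace E] {φ : Λ → E → E}
    {F : Set E} {a p : Λ → E → ℝ} {μ : Measure E} {K c D δ m : ℝ}

/-! ### Typical points visit every cylinder -/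

lemma sum_measureReal_cylinder_le [Fintype Λ] [IsFiniteMeasure μ]
    (h : UniformEstimates φ F a p μ K c D δ m)
    (u : List Λ) : ∑ j, μ.real (wordMap φ (u ++ [j]) '' F) ≤ μ.real (wordMap φ u '' F) := by
  rw [← measureReal_biUnion_finset]
  · refine measureReal_mono ?_
    exact iUnion₂_subset fun j _ => h.image_wordMap_append_subset u [j]
  · intro i _ j _ hij
    refine disjoint_left.2 ?_
    rintro _ ⟨x, hx, rfl⟩ ⟨y, hy, hxy⟩
    rw [wordMap_append, wordMap_append] at hxy
    have := injOn_wordMap h.mapsTo h.injOn u (h.mapsTo j hy) (h.mapsTo i hx) hxy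
    have h1 := h.separation i j hij x hx y hy
    replace this : φ j y = φ i x := this
    rw [this, dist_self] at h1
    exact absurd h.δ_pos (not_lt.2 h1)
  · exact fun j _ => h.measurableSet_cylinder _

/-- Almost every point of `F` lies in `φ_{uv}(F)` for some word `u`. -/
lemma measure_diff_iUnion_cylinder [Fintype Λ] [IsFiniteMeasure μ]
    (h : UniformEstimates φ F a p μ K c D δ m) (v : List Λ) :
    μ (F \ ⋃ u : List Λ, wordMap φ (u ++ v) '' F) = 0 := by
  classical
  set N := F \ ⋃ u : List Λ, wordMap φ (u ++ v) '' F with hN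
  have hNF : N ⊆ F := sdiff_subset
  have hcoverN : ∀ x ∈ N, ∃ i, ∃ y ∈ N, φ i y = x := by
    rintro x ⟨hx, hxN⟩
    obtain ⟨i, y, hy, rfl⟩ := h.cover x hx
    refine ⟨i, y, ⟨hy, fun hyU => hxN ?_⟩, rfl⟩
    obtain ⟨u, t, ht, rfl⟩ := mem_iUnion.1 hyU
    exact mem_iUnion.2 ⟨i :: u, t, ht, rfl⟩
  -- Here `N` is the set of points never entering a cylinder ending in `v`, and it is covered by its
  -- own images under the maps. If `N` has density at most `b` in every cylinder, removing
  -- `φ_{v'}(F)` from `N` saves `b` times the measure of `φ_{uv'}(F)`: follow the letters of `v'`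
  -- and apply the density bound to every branch that leaves them. For `v' = v` nothing is removed
  -- from `N`, so the density bound improves.
  have step : ∀ b : ℝ, 0 ≤ b → (∀ u, μ.real (wordMap φ u '' N) ≤ b * μ.real (wordMap φ u '' F)) →
      ∀ v' u, μ.real (wordMap φ u '' (N \ wordMap φ v' '' F)) ≤
        b * (μ.real (wordMap φ u '' F) - μ.real (wordMap φ (u ++ v') '' F)) := by
    intro b hb hbN v'
    induction v' with
    | nil =>
      intro u
      have : N \ wordMap φ [] '' F = ∅ := by
        rw [sdiff_eq_empty]
        exact fun x hx => ⟨x, hNF hx, rfl⟩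
      simp [this]
    | cons i v' ih =>
      intro u
      have hsub : wordMap φ u '' (N \ wordMap φ (i :: v') '' F) ⊆
          (⋃ j ∈ Finset.univ.erase i, wordMap φ (u ++ [j]) '' N) ∪
            wordMap φ (u ++ [i]) '' (N \ wordMap φ v' '' F) := by
        rintro _ ⟨x, ⟨hxN, hxv⟩, rfl⟩
        obtain ⟨j, y, hy, rfl⟩ := hcoverN x hxN
        by_cases hij : j = i
        · subst hij
          refine Or.inr ⟨y, ⟨hy, ?_⟩, by rw [wordMap_append]; rfl⟩
          rintro ⟨t, ht, rfl⟩
          exact hxv ⟨t, ht, rfl⟩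
        · refine Or.inl (mem_iUnion₂.2 ⟨j, by simpa using hij, y, hy, by rw [wordMap_append]; rfl⟩)
      have hsum := h.sum_measureReal_cylinder_le u
      rw [← Finset.add_sum_erase _ _ (Finset.mem_univ i)] at hsum
      have hi := ih (u ++ [i])
      rw [List.append_assoc, List.singleton_append] at hi
      calc μ.real (wordMap φ u '' (N \ wordMap φ (i :: v') '' F))
          ≤ μ.real (⋃ j ∈ Finset.univ.erase i, wordMap φ (u ++ [j]) '' N) +
            μ.real (wordMap φ (u ++ [i]) '' (N \ wordMap φ v' '' F)) :=
            (measureReal_mono hsub).trans (measureReal_union_le _ _)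
        _ ≤ (∑ j ∈ Finset.univ.erase i, b * μ.real (wordMap φ (u ++ [j]) '' F)) +
            b * (μ.real (wordMap φ (u ++ [i]) '' F) - μ.real (wordMap φ (u ++ i :: v') '' F)) := by
            refine add_le_add ((measureReal_biUnion_finset_le _ _).trans ?_) hi
            exact Finset.sum_le_sum fun j _ => hbN _
        _ = b * (μ.real (wordMap φ (u ++ [i]) '' F) +
              ∑ j ∈ Finset.univ.erase i, μ.real (wordMap φ (u ++ [j]) '' F) -
              μ.real (wordMap φ (u ++ i :: v') '' F)) := by rw [← Finset.mul_sum]; ring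
        _ ≤ _ := by gcongr
  have hNv : N \ wordMap φ v '' F = N := by
    rw [sdiff_eq_left, disjoint_left]
    exact fun x hx hxv => hx.2 (mem_iUnion.2 ⟨[], hxv⟩)
  have hK := h.K_pos
  have hFne : F.Nonempty := by
    rw [nonempty_iff_ne_empty]
    intro e
    have := h.measureReal_eq_one
    simp [e] at this
  obtain ⟨z, hz⟩ := hFne
  -- By the Gibbs property, used once for `u` and once for `uv`, `φ_{uv}(F)` fills at least the
  -- proportion `θ` of `φ_u(F)`. Each use of `step` thus multiplies the density bound by `1 - θ`.
  set θ := μ.real (wordMap φ v '' F) / K ^ 2 with hθ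
  have hθ0 : 0 < θ := by
    have h1 := h.le_measureReal_cylinder v hz
    have h2 := h.cocycle_p_pos v hz
    have : 0 < μ.real (wordMap φ v '' F) := pos_of_mul_pos_right (h2.trans_le h1) hK.le
    positivity
  have hmix : ∀ u, θ * μ.real (wordMap φ u '' F) ≤ μ.real (wordMap φ (u ++ v) '' F) := by
    intro u
    have h1 := h.measureReal_cylinder_le u hz
    have h2 := h.le_measure u z hz _ (h.image_wordMap_subset v) (h.measurableSet_cylinder v)
    have h3 : wordMap φ u '' (wordMap φ v '' F) = wordMap φ (u ++ v) '' F := by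
      rw [image_image]
      simp_rw [← wordMap_append]
    rw [h3] at h2
    calc θ * μ.real (wordMap φ u '' F) ≤ θ * (K * cocycle φ p u z) := by gcongr
      _ = cocycle φ p u z * μ.real (wordMap φ v '' F) / K := by rw [hθ]; field_simp
      _ ≤ _ := by rw [div_le_iff₀ hK, mul_comm _ K]; exact h2
  have hθ1 : θ ≤ 1 := by
    have h1 := hmix []
    have h2 : μ.real (wordMap φ v '' F) ≤ 1 := by
      rw [← h.measureReal_eq_one]
      exact measureReal_mono (h.image_wordMap_subset v)
    have h3 : wordMap φ ([] : List Λ) '' F = F := image_id F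
    rw [h3, h.measureReal_eq_one, List.nil_append] at h1
    linarith
  have hpow : ∀ k : ℕ, ∀ u, μ.real (wordMap φ u '' N) ≤ (1 - θ) ^ k * μ.real (wordMap φ u '' F) := by
    intro k
    induction k with
    | zero =>
      intro u
      rw [pow_zero, one_mul]
      exact measureReal_mono (image_mono hNF)
    | succ k ih =>
      intro u
      have hb : 0 ≤ (1 - θ) ^ k := pow_nonneg (by linarith) _
      have := step _ hb ih v u
      rw [hNv] at this
      refine this.trans ?_
      rw [pow_succ, mul_assoc]
      gcongr
      linarith [hmix u]
  have hlim : Tendsto (fun k : ℕ => (1 - θ) ^ k) atTop (𝓝 0) :=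
    tendsto_pow_atTop_nhds_zero_of_lt_one (by linarith) (by linarith)
  have h0 : μ.real N ≤ 0 := by
    refine ge_of_tendsto' hlim fun k => ?_
    have := hpow k []
    have e1 : wordMap φ ([] : List Λ) '' F = F := image_id F
    have e2 : wordMap φ ([] : List Λ) '' N = N := image_id N
    rwa [e1, e2, h.measureReal_eq_one, mul_one] at this
  exact (measureReal_eq_zero_iff (measure_ne_top _ _)).1 (le_antisymm h0 measureReal_nonneg)

lemma ae_exists_mem_cylinder [Fintype Λ] [IsFiniteMeasure μ]
    (h : UniformEstimates φ F a p μ K c D δ m) :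
    ∀ᵐ x ∂μ, x ∈ F ∧ ∀ v : List Λ, ∃ u : List Λ, x ∈ wordMap φ (u ++ v) '' F := by
  have hF : ∀ᵐ x ∂μ, x ∈ F := h.compl_null
  have hv : ∀ᵐ x ∂μ, ∀ v : List Λ, x ∉ F \ ⋃ u : List Λ, wordMap φ (u ++ v) '' F :=
    ae_all_iff.2 fun v => measure_eq_zero_iff_ae_notMem.1 (h.measure_diff_iUnion_cylinder v)
  filter_upwards [hF, hv] with x hx hxv
  refine ⟨hx, fun v => ?_⟩
  by_contra hne
  exact hxv v ⟨hx, fun hU => hne (mem_iUnion.1 hU)⟩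

/-! ### Upper bound -/

/-- Enclose `B(x, R) ∩ F` in the cylinder of depth `k` and find the cylinder of depth `n` inside
`B(x, r)`. The block `v` between the depths has `a_v ≥ b * (r / R)`, and the ratio of measures is at
most of order `1 / p_v`, which the hypothesis bounds by `a_v ^ (-s)`. -/
lemma exists_measure_div_le [IsFiniteMeasure μ]
    (h : UniformEstimates φ F a p μ K c D δ m) {s C : ℝ} (hs : 0 < s)
    (hC : ∀ u, ∀ z ∈ F, cocycle φ a u z ^ s ≤ C * cocycle φ p u z) {x : E} (hx : x ∈ F) :
    ∃ C' : ℝ, 0 < C' ∧ ∀ r R : ℝ, 0 < r → r < R →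
      μ (Metric.closedBall x R) / μ (Metric.closedBall x r) ≤ ENNReal.ofReal (C' * (R / r) ^ s) := by
  have hK := h.K_pos
  have hD := h.D_pos
  have hm := h.m_pos
  have hδ := h.δ_pos
  have hC0 : 0 < C := by
    have := hC [] x hx
    simp only [cocycle_nil, Real.one_rpow, mul_one] at this
    linarith
  set κ := δ / K ^ 2 with hκdef
  have hκ : 0 < κ := by positivity
  -- Each factor `m` pays for one letter lost in the minimal choice of `k` and of `n`; `κ` and `K *
  -- D` come from comparing balls with cylinders.
  set b := m * m * κ / (K * D) with hb
  have hb0 : 0 < b := by positivity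
  obtain ⟨w, T, hT0, hTF, hT⟩ := exists_coding_orbit h.cover hx
  have hT' : ∀ n, wordMap φ (prefixWord w n) (T n) = x := by
    intro n
    have := hT 0 n
    rwa [zero_add, Function.iterate_zero_apply, hT0] at this
  set A : ℕ → ℝ := fun n => cocycle φ a (prefixWord w n) (T n) with hA
  have hApos : ∀ n, 0 < A n := fun n => h.cocycle_a_pos _ (hTF n)
  have hAadd : ∀ k l, A (k + l) = A k * cocycle φ a (prefixWord (shift^[k] w) l) (T (k + l)) := by
    intro k l
    simp only [hA]
    rw [prefixWord_add, cocycle_append, hT]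
  have hAsucc : ∀ k, m * A k ≤ A (k + 1) := by
    intro k
    rw [hAadd k 1, mul_comm m]
    have : m ≤ cocycle φ a (prefixWord (shift^[k] w) 1) (T (k + 1)) := by
      simpa [prefixWord_succ] using h.le_a _ _ (hTF (k + 1))
    have := hApos k
    gcongr
  have hAlim : Tendsto A atTop (𝓝 0) := by
    have : Tendsto (fun n : ℕ => K * c ^ n) atTop (𝓝 (K * 0)) :=
      (tendsto_pow_atTop_nhds_zero_of_lt_one h.c_pos.le h.c_lt_one).const_mul K
    rw [mul_zero] at this
    refine squeeze_zero (fun n => (hApos n).le) (fun n => ?_) this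
    simpa using h.cocycle_a_le_pow (prefixWord w n) _ (hTF n)
  refine ⟨max 1 (K ^ 2 * C / b ^ s), lt_max_of_lt_left one_pos, fun r R hr hrR => ?_⟩
  have hR : 0 < R := hr.trans hrR
  have hRr : 1 ≤ (R / r) ^ s := Real.one_le_rpow ((one_le_div hr).2 hrR.le) hs.le
  rw [measure_div_le_ofReal_iff (by positivity)]
  -- The index `k + 1` makes minimality say `R < κ * A k` for `k > 0`; for `k = 0` the enclosing
  -- cylinder is all of `F` and nothing is needed.
  have ex1 : ∃ k, κ * A (k + 1) ≤ R := by
    have : Tendsto (fun k => κ * A (k + 1)) atTop (𝓝 (κ * 0)) :=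
      ((tendsto_add_atTop_iff_nat 1).2 hAlim).const_mul κ
    rw [mul_zero] at this
    exact (this.eventually (ge_mem_nhds hR)).exists
  have ex2 : ∃ n, K * A n * D ≤ r := by
    have : Tendsto (fun k => K * A k * D) atTop (𝓝 (K * 0 * D)) :=
      (hAlim.const_mul K).mul_const D
    rw [mul_zero, zero_mul] at this
    exact (this.eventually (ge_mem_nhds hr)).exists
  classical
  obtain ⟨k, hk, hkmin⟩ : ∃ k, κ * A (k + 1) ≤ R ∧ ∀ j < k, R < κ * A (j + 1) :=
    ⟨Nat.find ex1, Nat.find_spec ex1, fun j hj => not_le.1 (Nat.find_min ex1 hj)⟩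
  obtain ⟨n, hn, hnmin⟩ : ∃ n, K * A n * D ≤ r ∧ ∀ j < n, r < K * A j * D :=
    ⟨Nat.find ex2, Nat.find_spec ex2, fun j hj => not_le.1 (Nat.find_min ex2 hj)⟩
  have hBR : Metric.closedBall x R ∩ F ⊆ wordMap φ (prefixWord w k) '' F := by
    cases k with
    | zero => exact fun y hy => ⟨y, hy.2, rfl⟩
    | succ k =>
      have := h.inter_closedBall_subset_cylinder (prefixWord w (k + 1)) (hTF (k + 1))
        (hkmin k (Nat.lt_succ_self k))
      rwa [hT'] at this
  have hBr : wordMap φ (prefixWord w n) '' F ⊆ Metric.closedBall x r := by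
    have := h.cylinder_subset_closedBall (prefixWord w n) (hTF n) hn
    rwa [hT'] at this
  have hmR := h.measureReal_le_of_inter_subset hBR
  have hmr : μ.real (wordMap φ (prefixWord w n) '' F) ≤ μ.real (Metric.closedBall x r) :=
    measureReal_mono hBr
  -- If `n ≤ k`, the cylinders are nested the favourable way and the constant `1` suffices, which
  -- explains the maximum in the witness.
  rcases le_total n k with hnk | hkn
  · obtain ⟨l, rfl⟩ := Nat.exists_eq_add_of_le hnk
    have h1 : μ.real (wordMap φ (prefixWord w (n + l)) '' F) ≤
        μ.real (wordMap φ (prefixWord w n) '' F) := by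
      rw [prefixWord_add]
      exact measureReal_mono (h.image_wordMap_append_subset _ _)
    calc _ ≤ 1 * μ.real (Metric.closedBall x r) := by linarith
      _ ≤ _ := by
        gcongr
        exact one_le_mul_of_one_le_of_one_le (le_max_left _ _) hRr
  · rcases n.eq_zero_or_pos with rfl | hnpos
    · obtain rfl : k = 0 := by omega
      calc _ ≤ 1 * μ.real (Metric.closedBall x r) := by linarith
        _ ≤ _ := by
          gcongr
          exact one_le_mul_of_one_le_of_one_le (le_max_left _ _) hRr
    obtain ⟨l, rfl⟩ := Nat.exists_eq_add_of_le hkn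
    set v := prefixWord (shift^[k] w) l with hv
    have hTk : wordMap φ v (T (k + l)) = T k := hT k l
    have hAn : m * r ≤ K * A (k + l) * D := by
      obtain ⟨j, hj⟩ := Nat.exists_eq_succ_of_ne_zero hnpos.ne'
      rw [hj]
      calc m * r ≤ m * (K * A j * D) := by gcongr; exact (hnmin j (by omega)).le
        _ = K * (m * A j) * D := by ring
        _ ≤ _ := by gcongr; exact hAsucc j
    have hAk : κ * (m * A k) ≤ R := le_trans (by gcongr; exact hAsucc k) hk
    have hav : b * (r / R) ≤ cocycle φ a v (T (k + l)) := by
      have e := hAadd k l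
      have hcv := h.cocycle_a_pos v (hTF (k + l))
      have hk0 := hApos k
      rw [e] at hAn
      rw [hb, div_mul_div_comm, div_le_iff₀ (by positivity)]
      calc m * m * κ * r = κ * m * (m * r) := by ring
        _ ≤ κ * m * (K * (A k * cocycle φ a v (T (k + l))) * D) := by gcongr
        _ = cocycle φ a v (T (k + l)) * (K * D * (κ * (m * A k))) := by ring
        _ ≤ cocycle φ a v (T (k + l)) * (K * D * R) := by gcongr
    have hpv : b ^ s * (r / R) ^ s ≤ C * cocycle φ p v (T (k + l)) := by
      rw [← Real.mul_rpow hb0.le (by positivity)]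
      exact (Real.rpow_le_rpow (by positivity) hav hs.le).trans (hC v _ (hTF _))
    have hm1 := h.measureReal_cylinder_le (prefixWord w k) (hTF k)
    have hm2 := h.le_measureReal_cylinder (prefixWord w (k + l)) (hTF (k + l))
    rw [prefixWord_add, cocycle_append, ← hv, hTk] at hm2
    rw [prefixWord_add, ← hv] at hmr
    set P := cocycle φ p (prefixWord w k) (T k) with hP
    have hP0 : 0 < P := h.cocycle_p_pos _ (hTF k)
    have hbs : 0 < b ^ s := Real.rpow_pos_of_pos hb0 s
    have hrs : (r / R) ^ s * (R / r) ^ s = 1 := by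
      rw [← Real.mul_rpow (by positivity) (by positivity),
        div_mul_div_cancel₀ hR.ne', div_self hr.ne', Real.one_rpow]
    have hRs : 0 < (R / r) ^ s := by positivity
    calc μ.real (Metric.closedBall x R) ≤ K * P := hmR.trans hm1
      _ = K * P / b ^ s * (R / r) ^ s * (b ^ s * (r / R) ^ s) := by
          rw [show K * P / b ^ s * (R / r) ^ s * (b ^ s * (r / R) ^ s)
            = K * P * (b ^ s / b ^ s) * ((r / R) ^ s * (R / r) ^ s) by ring, hrs, div_self hbs.ne']
          ring
      _ ≤ K * P / b ^ s * (R / r) ^ s * (C * cocycle φ p v (T (k + l))) := by gcongr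
      _ = K * C / b ^ s * (R / r) ^ s * (P * cocycle φ p v (T (k + l))) := by ring
      _ ≤ K * C / b ^ s * (R / r) ^ s * (K * μ.real (Metric.closedBall x r)) := by
          refine mul_le_mul_of_nonneg_left (hm2.trans ?_) (by positivity)
          gcongr
      _ = K ^ 2 * C / b ^ s * (R / r) ^ s * μ.real (Metric.closedBall x r) := by ring
      _ ≤ _ := by gcongr; exact le_max_right _ _

/-! ### Lower bound -/

/-- Since `x` lies in some `φ_{uw}(F)`, the hypothesis at radii of the sizes of `φ_u(F)` and
`φ_{uw}(F)` gives `a_w ^ s ≤ C' p_w` with `C'` independent of `w`. Powers of `v` at its fixed point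
then remove `C'`. -/
lemma cocycle_rpow_le_of_measure_div_le [IsFiniteMeasure μ]
    (h : UniformEstimates φ F a p μ K c D δ m) {s C : ℝ} (hs : 0 < s) (hC0 : 0 < C) {x : E}
    (hx : ∀ v : List Λ, ∃ u : List Λ, x ∈ wordMap φ (u ++ v) '' F)
    (hC : ∀ r R : ℝ, 0 < r → r < R →
      μ (Metric.closedBall x R) / μ (Metric.closedBall x r) ≤ ENNReal.ofReal (C * (R / r) ^ s))
    {v : List Λ} {z : E} (hz : z ∈ F) (hvz : wordMap φ v z = z) :
    cocycle φ a v z ^ s ≤ cocycle φ p v z := by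
  have hK := h.K_pos
  have hD := h.D_pos
  have hδ := h.δ_pos
  set κ := δ / K ^ 2 with hκdef
  have hκ : 0 < κ := by positivity
  have ha0 := h.cocycle_a_pos v hz
  have hp0 := h.cocycle_p_pos v hz
  have hball : ∀ w : List Λ, cocycle φ a w z ^ s ≤
      C * K ^ 4 * (2 * K ^ 2 * (D + κ) / κ) ^ s * cocycle φ p w z := by
    intro w
    obtain ⟨u, y, hy, hxy⟩ := hx w
    have hyw := wordMap_mem h.mapsTo w hy
    set A := cocycle φ a u (wordMap φ w y) with hA
    have hA0 : 0 < A := h.cocycle_a_pos u hyw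
    have haw := h.cocycle_a_pos w hy
    have hawz := h.cocycle_a_pos w hz
    have hpwz := h.cocycle_p_pos w hz
    have hpu := h.cocycle_p_pos u hz
    -- The summand `κ` ensures `r < R`; the half in `r` gives the strict inequality needed to trap
    -- the small ball in the cylinder of `uw`.
    set R := K * A * (D + κ) with hRdef
    set r := κ / 2 * (A * cocycle φ a w y) with hrdef
    have hr : 0 < r := by positivity
    have hrR : r < R := by
      calc r ≤ κ / 2 * (A * K) := by rw [hrdef]; gcongr; exact h.cocycle_a_le_K w hy
        _ < K * A * (D + κ) := by
          nlinarith [mul_pos hK hA0, mul_pos (mul_pos hK hA0) hκ, mul_pos (mul_pos hK hA0) hD]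
    have hBR : wordMap φ u '' F ⊆ Metric.closedBall x R := by
      rw [← hxy, wordMap_append]
      exact h.cylinder_subset_closedBall u hyw (by rw [hRdef]; gcongr; linarith)
    have hBr : Metric.closedBall x r ∩ F ⊆ wordMap φ (u ++ w) '' F := by
      rw [← hxy]
      refine h.inter_closedBall_subset_cylinder (u ++ w) hy ?_
      rw [cocycle_append]
      have : 0 < κ * (A * cocycle φ a w y) := by positivity
      rw [hrdef]
      linarith
    have hratio := (measure_div_le_ofReal_iff (by positivity)).1 (hC r R hr hrR)
    have hm1 := h.le_measureReal_cylinder u hz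
    have hm2 := h.measureReal_cylinder_le (u ++ w) hz
    rw [cocycle_append] at hm2
    have hm3 := h.cocycle_p_le u _ (wordMap_mem h.mapsTo w hz) _ hz
    have hmR : μ.real (wordMap φ u '' F) ≤ μ.real (Metric.closedBall x R) := measureReal_mono hBR
    have hmr := h.measureReal_le_of_inter_subset hBr
    have hRr : R / r ≤ 2 * K ^ 2 * (D + κ) / κ / cocycle φ a w z := by
      have := h.cocycle_a_le w _ hz _ hy
      rw [hRdef, hrdef, div_div (2 * K ^ 2 * (D + κ)), div_le_div_iff₀ (by positivity) (by positivity)]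
      calc K * A * (D + κ) * (κ * cocycle φ a w z)
          ≤ K * A * (D + κ) * (κ * (K * cocycle φ a w y)) := by gcongr
        _ = 2 * K ^ 2 * (D + κ) * (κ / 2 * (A * cocycle φ a w y)) := by ring
    -- The factor `p_u` stands on both sides and cancels, so no trace of the uncontrolled prefix `u`
    -- remains.
    have hfin : cocycle φ p u z ≤ cocycle φ p u z * (C * K ^ 4 *
        (2 * K ^ 2 * (D + κ) / κ / cocycle φ a w z) ^ s * cocycle φ p w z) := by
      have hR0 : 0 < R / r := div_pos (hr.trans hrR) hr
      have hX : 0 ≤ (2 * K ^ 2 * (D + κ) / κ / cocycle φ a w z) ^ s := by positivity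
      have hK1 := h.one_le
      calc cocycle φ p u z ≤ K * (C * (R / r) ^ s * μ.real (Metric.closedBall x r)) :=
            hm1.trans (by gcongr; exact hmR.trans hratio)
        _ ≤ K * (C * (2 * K ^ 2 * (D + κ) / κ / cocycle φ a w z) ^ s *
              (K * (K * cocycle φ p u z * cocycle φ p w z))) := by
            gcongr
            refine (hmr.trans hm2).trans ?_
            gcongr
        _ = cocycle φ p u z * (C * K ^ 3 *
              (2 * K ^ 2 * (D + κ) / κ / cocycle φ a w z) ^ s * cocycle φ p w z) := by ring
        _ ≤ _ := by
            gcongr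
            norm_num
    have h1 : 1 ≤ C * K ^ 4 *
        (2 * K ^ 2 * (D + κ) / κ / cocycle φ a w z) ^ s * cocycle φ p w z := by
      by_contra hlt
      exact absurd hfin (not_le.2 (mul_lt_of_lt_one_right hpu (not_le.1 hlt)))
    have has : 0 < cocycle φ a w z ^ s := by positivity
    rw [Real.div_rpow (by positivity) hawz.le] at h1
    calc cocycle φ a w z ^ s = cocycle φ a w z ^ s * 1 := (mul_one _).symm
      _ ≤ cocycle φ a w z ^ s * (C * K ^ 4 *
            ((2 * K ^ 2 * (D + κ) / κ) ^ s / cocycle φ a w z ^ s) * cocycle φ p w z) := by gcongr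
      _ = _ := by field_simp
  refine le_of_forall_pow_le_mul_pow hp0 (C := C * K ^ 4 * (2 * K ^ 2 * (D + κ) / κ) ^ s) ?_
  intro N
  have := hball (List.replicate N v).flatten
  rw [cocycle_flatten_replicate hvz, cocycle_flatten_replicate hvz] at this
  rwa [← Real.rpow_natCast, ← Real.rpow_mul ha0.le, mul_comm s, Real.rpow_mul ha0.le,
    Real.rpow_natCast]

/-- The derivative at the fixed point of a non-empty word is a contraction. -/
lemma cocycle_a_lt_one (h : UniformEstimates φ F a p μ K c D δ m) {v : List Λ} (hv : v ≠ [])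
    {z : E} (hz : z ∈ F) (hvz : wordMap φ v z = z) : cocycle φ a v z < 1 := by
  have hc := h.c_pos
  have hle : cocycle φ a v z ≤ c ^ v.length := by
    refine le_of_forall_pow_le_mul_pow (C := K) (by positivity) fun N => ?_
    have := h.cocycle_a_le_pow (List.replicate N v).flatten z hz
    rw [cocycle_flatten_replicate hvz] at this
    simpa [← pow_mul, mul_comm] using this
  exact hle.trans_lt (pow_lt_one₀ hc.le h.c_lt_one (by simpa using hv))

end UniformEstimates

/-! ### Periodic words -/

/-- Multiplying by `log b < 0` reverses the inequality. -/
lemma log_div_log_le_iff {q b s : ℝ} (hq : 0 < q) (hb : 0 < b) (hb1 : b < 1) :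
    Real.log q / Real.log b ≤ s ↔ b ^ s ≤ q := by
  rw [div_le_iff_of_neg (Real.log_neg hb hb1), ← Real.log_rpow hb,
    Real.log_le_log_iff (Real.rpow_pos_of_pos hb s) hq]

lemma prefixWord_mul {Λ : Type*} {w : ℕ → Λ} {n : ℕ} (hw : shift^[n] w = w) (q : ℕ) :
    prefixWord w (n * q) = (List.replicate q (prefixWord w n)).flatten := by
  induction q with
  | zero => simp
  | succ q ih =>
    rw [Nat.mul_succ, add_comm, prefixWord_add, hw, ih, List.replicate_succ, List.flatten_cons]

/-- Every non-empty finite word is the first period of an infinite word. -/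
lemma exists_shift_iterate_eq_prefixWord_eq {Λ : Type*} {u : List Λ} (hu : u ≠ []) :
    ∃ w : ℕ → Λ, shift^[u.length] w = w ∧ prefixWord w u.length = u := by
  have hlen : 0 < u.length := List.length_pos_iff.2 hu
  refine ⟨fun k => u[k % u.length]'(Nat.mod_lt _ hlen), ?_, ?_⟩
  · funext k
    rw [shift_iterate_apply]
    simp
  · refine List.ext_getElem (by simp) fun k h1 h2 => ?_
    simp [prefixWord, Nat.mod_eq_of_lt h2]

/-! ### The coding map and the quantities of periodic words -/

section Coding

variable {Λ : Type*} {d : ℕ} {φ : Λ → EuclideanSpace ℝ (Fin d) → EuclideanSpace ℝ (Fin d)}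
  {F : Set (EuclideanSpace ℝ (Fin d))} {a p : Λ → EuclideanSpace ℝ (Fin d) → ℝ}
  {μ : Measure (EuclideanSpace ℝ (Fin d))} {K c D δ m : ℝ}

lemma prefixMap_eq_wordMap (w : ℕ → Λ) (n : ℕ) :
    prefixMap φ w n = wordMap φ (prefixWord w n) := by
  induction n with
  | zero => rfl
  | succ n ih =>
    funext x
    rw [prefixWord_succ', wordMap_append, ← ih]
    rfl

namespace UniformEstimates

/-- Justifies the choice in `codingMap`: the cylinders are nested non-empty compact sets whose
diameters are at most `K * (K * c ^ (n + 1)) * D`. -/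
lemma singleton_codingMap (h : UniformEstimates φ F a p μ K c D δ m) (hF : IsCompact F)
    (hcont : ∀ i, ContinuousOn (φ i) F) (hne : F.Nonempty) (w : ℕ → Λ) :
    {codingMap φ F w} = ⋂ n : ℕ, prefixMap φ w (n + 1) '' F := by
  refine Classical.epsilon_spec (p := fun x => {x} = ⋂ n : ℕ, prefixMap φ w (n + 1) '' F) ?_
  simp_rw [prefixMap_eq_wordMap]
  have hcomp : ∀ n, IsCompact (wordMap φ (prefixWord w (n + 1)) '' F) := fun n =>
    hF.image_of_continuousOn (continuousOn_wordMap h.mapsTo hcont _)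
  obtain ⟨x, hx⟩ := IsCompact.nonempty_iInter_of_sequence_nonempty_isCompact_isClosed
    (fun n => wordMap φ (prefixWord w (n + 1)) '' F)
    (fun n => by
      rw [prefixWord_succ' w (n + 1)]
      exact h.image_wordMap_append_subset _ _)
    (fun n => hne.image _) (hcomp 0) (fun n => (hcomp n).isClosed)
  refine ⟨x, (Subset.antisymm ?_ ?_)⟩
  · rintro _ rfl
    exact hx
  · intro y hy
    rw [mem_singleton_iff, ← dist_le_zero]
    have hlim : Tendsto (fun n : ℕ => K * (K * c ^ (n + 1)) * D) atTop (𝓝 (K * (K * 0) * D)) :=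
      ((((tendsto_add_atTop_iff_nat 1).2 (tendsto_pow_atTop_nhds_zero_of_lt_one h.c_pos.le
        h.c_lt_one)).const_mul K).const_mul K).mul_const D
    rw [mul_zero, mul_zero, zero_mul] at hlim
    refine ge_of_tendsto' hlim fun n => ?_
    obtain ⟨s, hs, rfl⟩ := mem_iInter.1 hy n
    obtain ⟨t, ht, hts⟩ := mem_iInter.1 hx n
    rw [← hts]
    have h1 := h.cocycle_a_le_pow (prefixWord w (n + 1)) s hs
    rw [length_prefixWord] at h1
    have hK := h.K_pos
    have hc := h.c_pos
    exact (h.dist_wordMap_le _ s hs t ht).trans (by gcongr; exact h.dist_le s hs t ht)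

lemma codingMap_mem_cylinder (h : UniformEstimates φ F a p μ K c D δ m) (hF : IsCompact F)
    (hcont : ∀ i, ContinuousOn (φ i) F) (hne : F.Nonempty) (w : ℕ → Λ) (n : ℕ) :
    codingMap φ F w ∈ wordMap φ (prefixWord w (n + 1)) '' F := by
  have h1 : codingMap φ F w ∈ ⋂ n : ℕ, prefixMap φ w (n + 1) '' F := by
    rw [← h.singleton_codingMap hF hcont hne w]
    rfl
  have := mem_iInter.1 h1 n
  rwa [prefixMap_eq_wordMap] at this

lemma codingMap_mem (h : UniformEstimates φ F a p μ K c D δ m) (hF : IsCompact F)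
    (hcont : ∀ i, ContinuousOn (φ i) F) (hne : F.Nonempty) (w : ℕ → Λ) :
    codingMap φ F w ∈ F :=
  h.image_wordMap_subset _ (h.codingMap_mem_cylinder hF hcont hne w 0)

lemma map_codingMap_shift (h : UniformEstimates φ F a p μ K c D δ m) (hF : IsCompact F)
    (hcont : ∀ i, ContinuousOn (φ i) F) (hne : F.Nonempty) (w : ℕ → Λ) :
    φ (w 0) (codingMap φ F (shift w)) = codingMap φ F w := by
  have h1 : φ (w 0) (codingMap φ F (shift w)) ∈ ⋂ n : ℕ, prefixMap φ w (n + 1) '' F := by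
    refine mem_iInter.2 fun n => ?_
    rw [prefixMap_eq_wordMap, prefixWord_succ]
    cases n with
    | zero => exact ⟨_, h.codingMap_mem hF hcont hne _, rfl⟩
    | succ n =>
      obtain ⟨x, hx, hxe⟩ := h.codingMap_mem_cylinder hF hcont hne (shift w) n
      exact ⟨x, hx, by rw [wordMap_cons, hxe]⟩
  rwa [← h.singleton_codingMap hF hcont hne w] at h1

lemma wordMap_prefixWord_codingMap (h : UniformEstimates φ F a p μ K c D δ m) (hF : IsCompact F)
    (hcont : ∀ i, ContinuousOn (φ i) F) (hne : F.Nonempty) (w : ℕ → Λ) (n : ℕ) :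
    wordMap φ (prefixWord w n) (codingMap φ F (shift^[n] w)) = codingMap φ F w := by
  induction n generalizing w with
  | zero => rfl
  | succ n ih =>
    rw [prefixWord_succ, wordMap_cons, Function.iterate_succ_apply, ih,
      h.map_codingMap_shift hF hcont hne]

lemma cocycle_prefixWord_codingMap (h : UniformEstimates φ F a p μ K c D δ m) (hF : IsCompact F)
    (hcont : ∀ i, ContinuousOn (φ i) F) (hne : F.Nonempty)
    (g : Λ → EuclideanSpace ℝ (Fin d) → ℝ) (w : ℕ → Λ) (n : ℕ) :
    cocycle φ g (prefixWord w n) (codingMap φ F (shift^[n] w)) =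
      ∏ k ∈ Finset.range n, g (w k) (codingMap φ F (shift^[k + 1] w)) := by
  induction n generalizing w with
  | zero => rfl
  | succ n ih =>
    rw [prefixWord_succ, cocycle_cons, Function.iterate_succ_apply, ih,
      h.wordMap_prefixWord_codingMap hF hcont hne, Finset.prod_range_succ', mul_comm]
    rfl

/-- Shifting by the minimal period returns `w`, so the orbit ends at the point it started from. For
a non-periodic `w` the minimal period is `0` and both sides are `1`. -/
lemma periodProb_eq (h : UniformEstimates φ F a p μ K c D δ m) (hF : IsCompact F)
    (hcont : ∀ i, ContinuousOn (φ i) F) (hne : F.Nonempty) (w : ℕ → Λ) :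
    periodProb φ F p w =
      cocycle φ p (prefixWord w (Function.minimalPeriod shift w)) (codingMap φ F w) := by
  have := h.cocycle_prefixWord_codingMap hF hcont hne p w (Function.minimalPeriod shift w)
  rw [Function.iterate_minimalPeriod] at this
  rw [this, periodProb]

end UniformEstimates

/-- A composition of conformal maps is conformal, and the ratios multiply. -/
lemma exists_hasFDerivAt_wordMap {Ω : Set (EuclideanSpace ℝ (Fin d))}
    (hmaps : ∀ i, MapsTo (φ i) Ω Ω) (hdiff : ∀ i, ∀ x ∈ Ω, DifferentiableAt ℝ (φ i) x)
    (hconf : ∀ i, ∀ x ∈ Ω, ∀ v, ‖fderiv ℝ (φ i) x v‖ = ‖fderiv ℝ (φ i) x‖ * ‖v‖) (u : List Λ)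
    {x : EuclideanSpace ℝ (Fin d)} (hx : x ∈ Ω) :
    ∃ L : EuclideanSpace ℝ (Fin d) →L[ℝ] EuclideanSpace ℝ (Fin d),
      HasFDerivAt (wordMap φ u) L x ∧
        ∀ v, ‖L v‖ = cocycle φ (fun i y => ‖fderiv ℝ (φ i) y‖) u x * ‖v‖ := by
  induction u with
  | nil => exact ⟨ContinuousLinearMap.id ℝ _, hasFDerivAt_id x, fun v => by simp⟩
  | cons i u ih =>
    obtain ⟨L, hL, hLn⟩ := ih
    have hux : wordMap φ u x ∈ Ω := wordMap_mem hmaps u hx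
    refine ⟨_, (hdiff i _ hux).hasFDerivAt.comp x hL, fun v => ?_⟩
    rw [ContinuousLinearMap.comp_apply, hconf i _ hux, hLn, cocycle_cons, mul_assoc]

/-- The operator norm of a similarity is its ratio, provided the space is not zero. -/
lemma norm_fderiv_prefixMap [Nontrivial (EuclideanSpace ℝ (Fin d))]
    {Ω : Set (EuclideanSpace ℝ (Fin d))}
    (hmaps : ∀ i, MapsTo (φ i) Ω Ω) (hdiff : ∀ i, ∀ x ∈ Ω, DifferentiableAt ℝ (φ i) x)
    (hconf : ∀ i, ∀ x ∈ Ω, ∀ v, ‖fderiv ℝ (φ i) x v‖ = ‖fderiv ℝ (φ i) x‖ * ‖v‖)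
    (w : ℕ → Λ) (n : ℕ) {x : EuclideanSpace ℝ (Fin d)} (hx : x ∈ Ω) :
    ‖fderiv ℝ (prefixMap φ w n) x‖ =
      cocycle φ (fun i y => ‖fderiv ℝ (φ i) y‖) (prefixWord w n) x := by
  obtain ⟨L, hL, hLn⟩ := exists_hasFDerivAt_wordMap hmaps hdiff hconf (prefixWord w n) hx
  rw [prefixMap_eq_wordMap, hL.fderiv]
  exact L.homothety_norm hLn

namespace UniformEstimates

/-- If `s` bounds the ratios of all periodic words, then `a_u ^ s ≤ C p_u` for all words `u`. -/
lemma exists_cocycle_rpow_le (h : UniformEstimates φ F a p μ K c D δ m) (hF : IsCompact F)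
    (hcont : ∀ i, ContinuousOn (φ i) F) (hne : F.Nonempty) {s : ℝ} (hs : 0 < s)
    (hper : ∀ w ∈ Function.periodicPts (shift (Λ := Λ)),
      cocycle φ a (prefixWord w (Function.minimalPeriod shift w)) (codingMap φ F w) ^ s ≤
        cocycle φ p (prefixWord w (Function.minimalPeriod shift w)) (codingMap φ F w)) :
    ∃ C : ℝ, ∀ u, ∀ z ∈ F, cocycle φ a u z ^ s ≤ C * cocycle φ p u z := by
  have hK := h.K_pos
  refine ⟨K ^ s * K, fun u z hz => ?_⟩
  by_cases hu : u = []
  · subst hu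
    simp only [cocycle_nil, Real.one_rpow, mul_one]
    exact one_le_mul_of_one_le_of_one_le (Real.one_le_rpow h.one_le hs.le) h.one_le
  obtain ⟨w, hw, hwu⟩ := exists_shift_iterate_eq_prefixWord_eq hu
  have hwp : Function.IsPeriodicPt shift u.length w := hw
  have hmem : w ∈ Function.periodicPts (shift (Λ := Λ)) :=
    Function.mk_mem_periodicPts (List.length_pos_iff.2 hu) hwp
  -- The minimal period may be shorter than `u`; it divides the length, so `u` is the `q`-th power
  -- of the true period `v`.
  obtain ⟨q, hq⟩ := hwp.minimalPeriod_dvd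
  have hmin : shift^[Function.minimalPeriod shift w] w = w := Function.iterate_minimalPeriod
  set π := codingMap φ F w with hπ
  have hπF : π ∈ F := h.codingMap_mem hF hcont hne w
  set v := prefixWord w (Function.minimalPeriod shift w) with hv
  have hvπ : wordMap φ v π = π := by
    have := h.wordMap_prefixWord_codingMap hF hcont hne w (Function.minimalPeriod shift w)
    rwa [hmin] at this
  have huv : u = (List.replicate q v).flatten := by
    rw [← hwu, hq, prefixWord_mul hmin]
  have hπu : cocycle φ a u π ^ s ≤ cocycle φ p u π := by
    have ha := h.cocycle_a_pos v hπF
    rw [huv, cocycle_flatten_replicate hvπ, cocycle_flatten_replicate hvπ, ← Real.rpow_natCast,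
      ← Real.rpow_mul ha.le, mul_comm _ s, Real.rpow_mul ha.le, Real.rpow_natCast]
    exact pow_le_pow_left₀ (Real.rpow_nonneg ha.le _) (hper w hmem) q
  have ha := h.cocycle_a_pos u hπF
  calc cocycle φ a u z ^ s ≤ (K * cocycle φ a u π) ^ s :=
        Real.rpow_le_rpow (h.cocycle_a_pos u hz).le (h.cocycle_a_le u z hz π hπF) hs.le
    _ = K ^ s * cocycle φ a u π ^ s := Real.mul_rpow hK.le ha.le
    _ ≤ K ^ s * (K * cocycle φ p u z) := by
        gcongr
        exact hπu.trans (h.cocycle_p_le u π hπF z hz)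
    _ = K ^ s * K * cocycle φ p u z := by ring

end UniformEstimates

end Coding

/-! ### Uniform estimates for self-conformal systems -/

section Construction

variable {Λ : Type*} {d : ℕ} {φ : Λ → EuclideanSpace ℝ (Fin d) → EuclideanSpace ℝ (Fin d)}
  {Ω X F : Set (EuclideanSpace ℝ (Fin d))}

lemma IsLimitSet.mapsTo (hF : IsLimitSet φ X F) (i : Λ) : MapsTo (φ i) F F := by
  intro x hx
  rw [hF.invariant]
  exact mem_iUnion.2 ⟨i, mem_image_of_mem _ hx⟩

lemma IsLimitSet.cover (hF : IsLimitSet φ X F) : ∀ x ∈ F, ∃ i, ∃ y ∈ F, φ i y = x := by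
  intro x hx
  rw [hF.invariant] at hx
  exact mem_iUnion.1 hx

lemma IsSelfConformal.differentiableAt (hφ : IsSelfConformal φ Ω X) (i : Λ)
    {x : EuclideanSpace ℝ (Fin d)} (hx : x ∈ Ω) : DifferentiableAt ℝ (φ i) x :=
  (((hφ.contDiffOn i).differentiableOn one_ne_zero) x hx).differentiableAt
    (hφ.isOpen_domain.mem_nhds hx)

lemma IsSelfConformal.norm_fderiv [Nontrivial (EuclideanSpace ℝ (Fin d))]
    (hφ : IsSelfConformal φ Ω X) (i : Λ) {x : EuclideanSpace ℝ (Fin d)} (hx : x ∈ Ω) :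
    0 < ‖fderiv ℝ (φ i) x‖ ∧ ∀ v, ‖fderiv ℝ (φ i) x v‖ = ‖fderiv ℝ (φ i) x‖ * ‖v‖ := by
  obtain ⟨c, hc, h⟩ := hφ.conformal i x hx
  have := (fderiv ℝ (φ i) x).homothety_norm h
  rw [this]
  exact ⟨hc, h⟩

lemma nontrivial_of_isPlaceDependentProb [Fintype Λ] {p : Λ → EuclideanSpace ℝ (Fin d) → ℝ}
    (hp : IsPlaceDependentProb p X) (hX : X.Nonempty) : Nontrivial Λ := by
  obtain ⟨x, hx⟩ := hX
  have hsum := hp.sum_eq_one x hx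
  have hne : Nonempty Λ := by
    by_contra hne
    rw [not_nonempty_iff] at hne
    simp at hsum
  by_contra hnt
  rw [not_nontrivial_iff_subsingleton] at hnt
  obtain ⟨i⟩ := hne
  rw [Fintype.sum_subsingleton _ i] at hsum
  exact (hp.mem_Ioo i x hx).2.ne hsum

/-- Two letters give two disjoint pieces of `F`. The second point serves to test derivatives by
distances and to exclude dimension zero. -/
lemma StrongSeparation.exists_ne (hsep : StrongSeparation φ F) (hF : IsLimitSet φ X F)
    [Nontrivial Λ] (x : EuclideanSpace ℝ (Fin d)) : ∃ y ∈ F, x ≠ y := by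
  obtain ⟨z, hz⟩ := hF.nonempty
  obtain ⟨i, j, hij⟩ := exists_pair_ne Λ
  by_cases hx : x = φ i z
  · refine ⟨φ j z, hF.mapsTo j hz, ?_⟩
    rintro rfl
    exact (hsep i j hij).le_bot ⟨⟨z, hz, hx.symm⟩, ⟨z, hz, rfl⟩⟩
  · exact ⟨φ i z, hF.mapsTo i hz, hx⟩

lemma StrongSeparation.exists_le_dist [Finite Λ] (hsep : StrongSeparation φ F) (hF : IsCompact F)
    (hcont : ∀ i, ContinuousOn (φ i) F) :
    ∃ δ : ℝ, 0 < δ ∧ ∀ i j, i ≠ j → ∀ x ∈ F, ∀ y ∈ F, δ ≤ dist (φ i x) (φ j y) := by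
  have h : ∀ i j, ∀ᶠ δ : ℝ in 𝓝[>] 0, i ≠ j → ∀ x ∈ F, ∀ y ∈ F, δ ≤ dist (φ i x) (φ j y) := by
    intro i j
    by_cases hij : i = j
    · exact Eventually.of_forall fun _ hne => absurd hij hne
    obtain ⟨r, hr, H⟩ := Metric.exists_pos_forall_lt_edist (hF.image_of_continuousOn (hcont i))
      (hF.image_of_continuousOn (hcont j)).isClosed (hsep i j hij)
    filter_upwards [Ioo_mem_nhdsGT (NNReal.coe_pos.2 hr)] with δ hδ _ x hx y hy
    have := H _ (mem_image_of_mem _ hx) _ (mem_image_of_mem _ hy)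
    rw [edist_nndist, ENNReal.coe_lt_coe, ← NNReal.coe_lt_coe, coe_nndist] at this
    exact (hδ.2.trans this).le
  have h' := eventually_all.2 fun i => eventually_all.2 fun j => h i j
  obtain ⟨δ, hδ, hδ0⟩ := (h'.and self_mem_nhdsWithin).exists
  exact ⟨δ, hδ0, hδ⟩

lemma IsSelfConformal.exists_contraction [Finite Λ] (hφ : IsSelfConformal φ Ω X) :
    ∃ c : ℝ, 0 < c ∧ c < 1 ∧
      ∀ i, ∀ x ∈ X, ∀ y ∈ X, dist (φ i x) (φ i y) ≤ c * dist x y := by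
  have h : ∀ i, ∀ᶠ c : ℝ in 𝓝[<] 1, ∀ x ∈ X, ∀ y ∈ X, dist (φ i x) (φ i y) ≤ c * dist x y := by
    intro i
    obtain ⟨c, hc, H⟩ := hφ.contraction i
    have hc' : (c : ℝ) < 1 := by exact_mod_cast hc
    filter_upwards [Ioo_mem_nhdsLT hc'] with b hb x hx y hy
    exact (H.dist_le_mul x hx y hy).trans (by gcongr; exact hb.1.le)
  -- Finitely many conditions each hold for `c` close to `1` from below, so one `c` in `(0, 1)`
  -- serves all maps.
  obtain ⟨c, hc, hc01⟩ := ((eventually_all.2 h).and (Ioo_mem_nhdsLT (one_pos (α := ℝ)))).exists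
  exact ⟨c, hc01.1, hc01.2, hc⟩

/-- A self-conformal system with strong separation satisfies the uniform estimates. -/
lemma exists_uniformEstimates [Fintype Λ] [Nontrivial Λ] [Nontrivial (EuclideanSpace ℝ (Fin d))]
    (hφ : IsSelfConformal φ Ω X) (hF : IsLimitSet φ X F)
    (hsep : StrongSeparation φ F) {p : Λ → EuclideanSpace ℝ (Fin d) → ℝ}
    (hp : IsPlaceDependentProb p X) {μ : Measure (EuclideanSpace ℝ (Fin d))}
    (hμ : IsInvariantMeasure φ p X μ) (hsupp : μ.support = F) :
    ∃ K c D δ m : ℝ,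
      UniformEstimates φ F (fun i x => ‖fderiv ℝ (φ i) x‖) p μ K c D δ m := by
  have hprob := hμ.isProbabilityMeasure
  set a : Λ → EuclideanSpace ℝ (Fin d) → ℝ := fun i x => ‖fderiv ℝ (φ i) x‖ with ha
  have hFc := hF.isCompact
  have hFX := hF.subset
  have hFΩ : F ⊆ Ω := hFX.trans hφ.subset_domain
  have hmaps := hF.mapsTo
  have hdiff : ∀ i, DifferentiableOn ℝ (φ i) Ω := fun i x hx =>
    (hφ.differentiableAt i hx).differentiableWithinAt
  have hcont : ∀ i, ContinuousOn (φ i) F := fun i => (hdiff i).continuousOn.mono hFΩ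
  have hinj : ∀ i, InjOn (φ i) F := fun i => (hφ.injOn_domain i).mono hFΩ
  have hapos : ∀ i, ∀ x ∈ F, 0 < a i x := fun i x hx => (hφ.norm_fderiv i (hFΩ hx)).1
  have hppos : ∀ i, ∀ x ∈ F, 0 < p i x := fun i x hx => (hp.mem_Ioo i x (hFX hx)).1
  have hμF : μ Fᶜ = 0 := by
    rw [← hsupp]
    exact Measure.measure_compl_support
  obtain ⟨c, hc0, hc1, hconX⟩ := hφ.exists_contraction
  have hcon : ∀ i, ∀ x ∈ F, ∀ y ∈ F, dist (φ i x) (φ i y) ≤ c * dist x y :=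
    fun i x hx y hy => hconX i x (hFX hx) y (hFX hy)
  obtain ⟨δ, hδ0, hδ⟩ := hsep.exists_le_dist hFc hcont
  set D := Metric.diam F + 1 with hDdef
  have hD0 : 0 < D := by have := Metric.diam_nonneg (s := F); positivity
  have hD : ∀ x ∈ F, ∀ y ∈ F, dist x y ≤ D := fun x hx y hy =>
    (Metric.dist_le_diam_of_mem hFc.isBounded hx hy).trans (by linarith)
  obtain ⟨ε, hε, hder⟩ := hφ.holder_deriv
  have hε' : (0 : ℝ) < ε := by exact_mod_cast hε
  have hder' : ∀ i, ∀ x ∈ Ω, ∃ C : ℝ, ∃ U ∈ 𝓝 x, ∀ y ∈ U ∩ Ω, ∀ z ∈ U ∩ Ω,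
      ‖fderiv ℝ (φ i) y - fderiv ℝ (φ i) z‖ ≤ C * dist y z ^ (ε : ℝ) := by
    intro i x hx
    obtain ⟨U, hU, C, H⟩ := hder i x hx
    refine ⟨C, U, hU, fun y hy z hz => ?_⟩
    rw [← dist_eq_norm]
    exact H.dist_le hy hz
  obtain ⟨ωa, ha0, hasum, hωa⟩ := exists_summable_modulus (F := F) hc0 hc1 hD0.le
    (q := fun i x y => Real.log (a i x) - Real.log (a i y)) (fun i => ⟨ε, hε', by
      refine exists_abs_log_sub_log_le hFc hε' (hapos i) fun x hx => ?_
      obtain ⟨C, U, hU, H⟩ := hder' i x (hFΩ hx)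
      exact ⟨C, U, hU, fun y hy z hz => (abs_norm_sub_norm_le _ _).trans
        (H y ⟨hy.1, hFΩ hy.2⟩ z ⟨hz.1, hFΩ hz.2⟩)⟩⟩)
  obtain ⟨ωp, hp0, hpsum, hωp⟩ := exists_summable_modulus (F := F) hc0 hc1 hD0.le
    (q := fun i x y => Real.log (p i x) - Real.log (p i y)) (fun i => by
      obtain ⟨C, α, hα, H⟩ := hp.holder i
      have hα' : (0 : ℝ) < α := by exact_mod_cast hα
      refine ⟨α, hα', exists_abs_log_sub_log_le hFc hα' (hppos i) fun x hx => ?_⟩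
      exact ⟨C, univ, univ_mem, fun y hy z hz => H.dist_le (hFX hy.2) (hFX hz.2)⟩)
  obtain ⟨ωd, hd0, hdsum, hωd⟩ := exists_summable_modulus (F := F) hc0 hc1 hD0.le
    (q := fun i x y => Real.log (dist (φ i x) (φ i y) / dist x y) - Real.log (a i x))
    (fun i => ⟨ε, hε', exists_abs_log_dist_sub_log_norm_fderiv_le hFc hφ.isOpen_domain hFΩ
      (hdiff i) (hφ.injOn_domain i) hε' (hapos i) (fun x hx => (hφ.norm_fderiv i hx).2)
      (hder' i)⟩)
  -- One `W` dominates the partial sums of all three moduli, so the single constant `exp W` controls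
  -- derivatives, probabilities and distances.
  set W := (∑' k, ωa k) + (∑' k, ωp k) + ∑' k, ωd k with hW
  have hta : 0 ≤ ∑' k, ωa k := tsum_nonneg ha0
  have htp : 0 ≤ ∑' k, ωp k := tsum_nonneg hp0
  have htd : 0 ≤ ∑' k, ωd k := tsum_nonneg hd0
  have hWa : ∀ n, ∑ k ∈ Finset.range n, ωa k ≤ W := fun n => by
    have := hasum.sum_le_tsum (Finset.range n) fun k _ => ha0 k
    linarith
  have hWp : ∀ n, ∑ k ∈ Finset.range n, ωp k ≤ W := fun n => by
    have := hpsum.sum_le_tsum (Finset.range n) fun k _ => hp0 k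
    linarith
  have hWd : ∀ n, ∑ k ∈ Finset.range n, ωd k ≤ W := fun n => by
    have := hdsum.sum_le_tsum (Finset.range n) fun k _ => hd0 k
    linarith
  set K := Real.exp W with hK
  have hK0 : 0 < K := Real.exp_pos W
  have hca : ∀ u, ∀ x ∈ F, ∀ y ∈ F, cocycle φ a u x ≤ K * cocycle φ a u y :=
    fun u x hx y hy => le_exp_mul_of_abs_log_sub_le (cocycle_pos hmaps hapos u hx)
      (cocycle_pos hmaps hapos u hy)
      ((abs_log_cocycle_sub_le hc0.le hmaps hcon hD hapos ha0 hωa u hx hy).trans (hWa _))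
  have hcp : ∀ u, ∀ x ∈ F, ∀ y ∈ F, cocycle φ p u x ≤ K * cocycle φ p u y :=
    fun u x hx y hy => le_exp_mul_of_abs_log_sub_le (cocycle_pos hmaps hppos u hx)
      (cocycle_pos hmaps hppos u hy)
      ((abs_log_cocycle_sub_le hc0.le hmaps hcon hD hppos hp0 hωp u hx hy).trans (hWp _))
  have hdist : ∀ u, ∀ x ∈ F, ∀ y ∈ F, x ≠ y →
      |Real.log (dist (wordMap φ u x) (wordMap φ u y) / dist x y) - Real.log (cocycle φ a u x)|
        ≤ W := fun u x hx y hy hxy =>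
    (abs_log_dist_wordMap_sub_le hc0.le hmaps hinj hcon hD hapos hωd u hx hy hxy).trans (hWd _)
  have hdpos : ∀ u, ∀ x ∈ F, ∀ y ∈ F, x ≠ y →
      0 < dist (wordMap φ u x) (wordMap φ u y) / dist x y := fun u x hx y hy hxy =>
    div_pos (dist_pos.2 fun e => hxy (injOn_wordMap hmaps hinj u hx hy e)) (dist_pos.2 hxy)
  have hled : ∀ u, ∀ x ∈ F, ∀ y ∈ F,
      cocycle φ a u x * dist x y ≤ K * dist (wordMap φ u x) (wordMap φ u y) := by
    intro u x hx y hy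
    by_cases hxy : x = y
    · simp [hxy]
    have := le_exp_mul_of_abs_log_sub_le (cocycle_pos hmaps hapos u hx) (hdpos u x hx y hy hxy)
      ((abs_sub_comm _ _).trans_le (hdist u x hx y hy hxy))
    rwa [← mul_div_assoc, le_div_iff₀ (dist_pos.2 hxy)] at this
  have hgibbs : ∀ u, ∀ z ∈ F, ∀ A ⊆ F, MeasurableSet A → _ := fun u z hz A hAF hA =>
    measureReal_image_wordMap_mem_Icc (μ := μ) hc0.le hmaps hcont hinj hcon hD hppos hp0 hωp
      (fun i A hAF hA => hμ.measure_image_eq hFX hμF hmaps hcont hinj hsep i hAF hA) u hz hAF hA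
  obtain ⟨x₀, hx₀⟩ := hF.nonempty
  -- Distortion of one-letter words carries the positive values at `x₀` to a lower bound on all of
  -- `F`.
  obtain ⟨m, hm, hm0⟩ : ∃ m : ℝ, (∀ i, m ≤ a i x₀ / K) ∧ 0 < m := by
    have h : ∀ i, ∀ᶠ m : ℝ in 𝓝[>] 0, m ≤ a i x₀ / K := by
      intro i
      filter_upwards [Ioo_mem_nhdsGT (div_pos (hapos i x₀ hx₀) hK0)] with m hm
      exact hm.2.le
    exact ((eventually_all.2 h).and self_mem_nhdsWithin).exists
  refine ⟨K, c, D, δ, m, ?_⟩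
  exact
    { one_le := Real.one_le_exp (by positivity)
      c_pos := hc0
      c_lt_one := hc1
      D_pos := hD0
      δ_pos := hδ0
      m_pos := hm0
      measurableSet_image := fun u A hAF hA =>
        measurableSet_image_wordMap hmaps hcont hinj u hA hAF
      measurableSet := hFc.measurableSet
      mapsTo := hmaps
      injOn := hinj
      cover := hF.cover
      separation := hδ
      dist_le := hD
      dist_wordMap_le := by
        intro u x hx y hy
        by_cases hxy : x = y
        · simp [hxy]
        have := le_exp_mul_of_abs_log_sub_le (hdpos u x hx y hy hxy)
          (cocycle_pos hmaps hapos u hx) (hdist u x hx y hy hxy)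
        rwa [div_le_iff₀ (dist_pos.2 hxy)] at this
      le_dist_wordMap := hled
      a_pos := hapos
      p_pos := hppos
      le_a := by
        intro i x hx
        refine (hm i).trans ?_
        rw [div_le_iff₀ hK0, mul_comm]
        simpa using hca [i] x₀ hx₀ x hx
      cocycle_a_le := hca
      cocycle_p_le := hcp
      cocycle_a_le_pow := by
        intro u x hx
        -- Contraction is known for distances, not for derivatives; a second point `y` transfers it
        -- to the cocycle at the cost of `K`.
        obtain ⟨y, hy, hxy⟩ := hsep.exists_ne hF x
        have h1 := hled u x hx y hy
        have h2 := dist_wordMap_le_pow hc0.le hmaps hcon u hx hy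
        refine le_of_mul_le_mul_right ?_ (dist_pos.2 hxy)
        calc _ ≤ K * dist (wordMap φ u x) (wordMap φ u y) := h1
          _ ≤ K * (c ^ u.length * dist x y) := by gcongr
          _ = _ := by ring
      measure_le := by
        intro u z hz A hAF hA
        refine (hgibbs u z hz A hAF hA).2.trans ?_
        have := cocycle_pos hmaps hppos u hz
        gcongr
        exact Real.exp_le_exp.2 (hWp _)
      le_measure := by
        intro u z hz A hAF hA
        have h1 := (hgibbs u z hz A hAF hA).1
        rw [Real.exp_neg, mul_assoc, inv_mul_le_iff₀ (Real.exp_pos _)] at h1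
        refine h1.trans ?_
        gcongr
        exact Real.exp_le_exp.2 (hWp _)
      measureReal_eq_one := by
        rw [measureReal_def, (prob_compl_eq_zero_iff hFc.measurableSet).1 hμF, ENNReal.toReal_one]
      compl_null := hμF }

end Construction

end ConformalIFS

/-! ### The almost sure formula -/

theorem mainTheorem5 {d : ℕ} {Λ : Type*} [Fintype Λ]
    (φ : Λ → EuclideanSpace ℝ (Fin d) → EuclideanSpace ℝ (Fin d))
    (Ω X F : Set (EuclideanSpace ℝ (Fin d)))
    (hφ : ConformalIFS.IsSelfConformal φ Ω X)
    (hF : ConformalIFS.IsLimitSet φ X F)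
    (hsep : ConformalIFS.StrongSeparation φ F)
    (p : Λ → EuclideanSpace ℝ (Fin d) → ℝ)
    (hp : ConformalIFS.IsPlaceDependentProb p X)
    (μ : MeasureTheory.Measure (EuclideanSpace ℝ (Fin d)))
    (hμ : ConformalIFS.IsInvariantMeasure φ p X μ)
    (hsupp : μ.support = F) :
    ∀ᵐ x ∂μ, ConformalIFS.pointwiseAssouadDim μ x =
      ⨆ w ∈ Function.periodicPts (ConformalIFS.shift (Λ := Λ)),
        ((Real.log (ConformalIFS.periodProb φ F p w) /
          Real.log (ConformalIFS.periodDeriv φ F w) : ℝ) : EReal) := by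
  open ConformalIFS in
  have hprob := hμ.isProbabilityMeasure
  obtain ⟨x₀, hx₀⟩ := hF.nonempty
  have hΛ : Nontrivial Λ := nontrivial_of_isPlaceDependentProb hp ⟨x₀, hF.subset hx₀⟩
  have hE : Nontrivial (EuclideanSpace ℝ (Fin d)) := by
    obtain ⟨y, -, hy⟩ := hsep.exists_ne hF x₀
    exact ⟨x₀, y, hy⟩
  obtain ⟨K, c, D, δ, m, h⟩ := exists_uniformEstimates hφ hF hsep hp hμ hsupp
  have hFΩ : F ⊆ Ω := hF.subset.trans hφ.subset_domain
  have hcont : ∀ i, ContinuousOn (φ i) F := fun i x hx =>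
    (hφ.differentiableAt i (hFΩ hx)).continuousAt.continuousWithinAt
  set a : Λ → EuclideanSpace ℝ (Fin d) → ℝ := fun i x => ‖fderiv ℝ (φ i) x‖ with ha
  have hπ := h.codingMap_mem hF.isCompact hcont hF.nonempty
  have hprobeq := h.periodProb_eq hF.isCompact hcont hF.nonempty
  have hderiveq : ∀ w : ℕ → Λ, periodDeriv φ F w =
      cocycle φ a (prefixWord w (Function.minimalPeriod shift w)) (codingMap φ F w) := fun w =>
    norm_fderiv_prefixMap hφ.mapsTo_domain (fun i x hx => hφ.differentiableAt i hx)
      (fun i x hx => (hφ.norm_fderiv i hx).2) w _ (hFΩ (hπ w))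
  have hfix : ∀ w : ℕ → Λ, wordMap φ (prefixWord w (Function.minimalPeriod shift w))
      (codingMap φ F w) = codingMap φ F w := fun w => by
    have := h.wordMap_prefixWord_codingMap hF.isCompact hcont hF.nonempty w
      (Function.minimalPeriod shift w)
    rwa [Function.iterate_minimalPeriod] at this
  have hratio : ∀ w ∈ Function.periodicPts (shift (Λ := Λ)), ∀ s : ℝ,
      Real.log (periodProb φ F p w) / Real.log (periodDeriv φ F w) ≤ s ↔
        cocycle φ a (prefixWord w (Function.minimalPeriod shift w)) (codingMap φ F w) ^ s ≤
          cocycle φ p (prefixWord w (Function.minimalPeriod shift w)) (codingMap φ F w) := by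
    intro w hw s
    rw [hprobeq, hderiveq]
    refine log_div_log_le_iff (h.cocycle_p_pos _ (hπ w)) (h.cocycle_a_pos _ (hπ w))
      (h.cocycle_a_lt_one ?_ (hπ w) (hfix w))
    rw [← List.length_pos_iff, length_prefixWord]
    exact Function.minimalPeriod_pos_of_mem_periodicPts hw
  filter_upwards [h.ae_exists_mem_cylinder] with x hx
  -- Upper bound: every real `s` above the supremum is admissible, using only `x ∈ F`. That `x`
  -- visits every cylinder matters only for the lower bound.
  refine le_antisymm (le_of_forall_gt_imp_ge_of_dense fun b hb => ?_) ?_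
  · obtain ⟨s, hs, hsb⟩ := EReal.lt_iff_exists_real_btwn.1 hb
    have hle : ∀ w ∈ Function.periodicPts (shift (Λ := Λ)),
        Real.log (periodProb φ F p w) / Real.log (periodDeriv φ F w) < s := fun w hw =>
      EReal.coe_lt_coe_iff.1 ((le_iSup₂ (f := fun w _ => ((Real.log (periodProb φ F p w) /
        Real.log (periodDeriv φ F w) : ℝ) : EReal)) w hw).trans_lt hs)
    -- Admissible exponents must be positive; a constant word is periodic with non-negative ratio,
    -- so the strict bound by `s` gives this.
    have hs0 : 0 < s := by
      let w : ℕ → Λ := fun _ => hΛ.to_nonempty.some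
      have hw : w ∈ Function.periodicPts (shift (Λ := Λ)) :=
        Function.mk_mem_periodicPts one_pos (show shift^[1] w = w from rfl)
      refine lt_of_le_of_lt ?_ (hle w hw)
      refine div_nonneg_of_nonpos (Real.log_nonpos ?_ ?_) (Real.log_nonpos (norm_nonneg _) ?_)
      · exact Finset.prod_nonneg fun k _ => (h.p_pos _ _ (hπ _)).le
      · exact Finset.prod_le_one (fun k _ => (h.p_pos _ _ (hπ _)).le)
          fun k _ => (hp.mem_Ioo _ _ (hF.subset (hπ _))).2.le
      · rw [hderiveq]
        refine (h.cocycle_a_lt_one ?_ (hπ w) (hfix w)).le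
        rw [← List.length_pos_iff, length_prefixWord]
        exact Function.minimalPeriod_pos_of_mem_periodicPts hw
    obtain ⟨C, hC⟩ := h.exists_cocycle_rpow_le hF.isCompact hcont hF.nonempty hs0
      fun w hw => (hratio w hw s).1 (hle w hw).le
    refine le_trans ?_ hsb.le
    rw [pointwiseAssouadDim]
    exact sInf_le ⟨s, ⟨hs0, h.exists_measure_div_le hs0 hC hx.1⟩, rfl⟩
  · refine iSup₂_le fun w hw => le_sInf ?_
    rintro _ ⟨s, ⟨hs0, C, hC0, hC⟩, rfl⟩
    refine EReal.coe_le_coe_iff.2 ((hratio w hw s).2 ?_)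
    exact h.cocycle_rpow_le_of_measure_div_le hs0 hC0 hx.2 hC (hπ w) (hfix w)
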